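/- Let $G$ be a finite simple graph (not necessarily connected) of order $n>2$ with $m$ edges, and let $\mu_1(G)\ge\mu_2(G)\ge\cdots\ge\mu_n(G)=0$ be the eigenvalues, with multiplicity, of its Laplacian matrix (degree matrix minus adjacency matrix). Write $G_1\cup G_2$ for the disjoint union of two graphs, $2G_1$ for $G_1\cup G_1$, $G_1\vee G_2$ for their join (the disjoint union with all edges between $G_1$ and $G_2$ added), and $K_k$ for the complete graph on $k$ vertices ($K_0$ being the graph without vertices). Suppose that $G\not\cong (K_1\cup K_{n-r-1})\vee K_r$ for every integer $r$ with $0\le r\le\lceil n/2\rceil-2$ or $r=n-2$. Then $$\mu_{n-2}(G)\le\frac{2m}{n}+1,$$ with equality if and only if $G\cong K_n$, or $n$ is even and $G\cong 2K_{n/2}$, or $n$ is even and $G\cong (K_1\cup K_{n/2})\vee K_{n/2-1}$. -/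

import Mathlib

/-- The join `G ∨ H` of two graphs: their disjoint union together with all edges between the
vertices of `G` and the vertices of `H`. -/
def graphJoin {V W : Type*} (G : SimpleGraph V) (H : SimpleGraph W) : SimpleGraph (V ⊕ W) :=
  SimpleGraph.sum G H ⊔ completeBipartiteGraph V W

/-- The complete graph `K_k` on `k` vertices (for `k = 0` the graph without vertices). -/
abbrev completeK (k : ℕ) : SimpleGraph (Fin k) := ⊤

/-- The graph `(K_1 ∪ K_a) ∨ K_b`. -/
abbrev pointUnionCliqueJoin (a b : ℕ) : SimpleGraph ((Fin 1 ⊕ Fin a) ⊕ Fin b) :=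
  graphJoin (SimpleGraph.sum (completeK 1) (completeK a)) (completeK b)

/-- The Laplacian eigenvalues of `G`, with multiplicity, in non-increasing order. The index starts
at `0`, so that `laplacianEigenvalue G ⟨i - 1, _⟩` is the `i`-th largest one, `μ_i(G)`. -/
noncomputable def laplacianEigenvalue {V : Type*} [Fintype V] [DecidableEq V]
    (G : SimpleGraph V) [DecidableRel G.Adj] : Fin (Fintype.card V) → ℝ :=
  (G.isHermitian_lapMatrix ℝ).eigenvalues₀

/-! Let `d` be the average degree of the complement `Gᶜ`; then `2m/n + 1 = n - d`. The Laplacian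
forms of `G` and `Gᶜ` add up to the form of `nI - J`, so `μ_{n-2}(G) = n - μ_2(Gᶜ)`, and the claim
says that the second largest Laplacian eigenvalue of the complement is at least its average degree.
A plane of vectors on which the form of `Gᶜ` is at least `c‖x‖²` proves `μ_2(Gᶜ) ≥ c`
(`laplacianEigenvalue_lt_of_compl_form`, `laplacianEigenvalue_le_of_compl_form`).

If `Gᶜ` is `k`-regular, bounds on the two smallest eigenvalues of `G` and its trace give the
inequality; in the equality case with `k ≥ 1`, the trace of the squared Laplacian forces two cliques
of size `n/2`.

If `Gᶜ` is a star with `s` leaves plus isolated vertices, then `d = 2s/n`. The excluded graphs are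
the cases `s = 1` and `s > n/2`; otherwise two leaves give `μ_2(Gᶜ) ≥ 1 ≥ d`, with equality only for
`s = n/2`.

In all other cases the bound is strict. Let `u` have maximal degree `D` in `Gᶜ` and let `k` be the
largest degree among the other vertices. If `d < k`, two vertices of degree at least `k` give
`μ_2(Gᶜ) ≥ k`. If `d ≥ k`, then `D > k`, and the plane is spanned by the indicator of `u` and either
the difference along an edge between two vertices of degree `k`, or, when there is no such edge, a
star vector at a vertex of degree `k`. In the latter case double counting shows that `D - k` is at
least `(n-1)/2`, which makes the determinant positive. -/

open Matrix

/-! ### Courant–Fischer bounds and traces for real symmetric matrices -/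

section Spectral

variable {V : Type*} [Fintype V] [DecidableEq V] {A : Matrix V V ℝ}

/-- A Hermitian real matrix has an orthonormal eigenbasis enumerated along `eigenvalues₀`. -/
theorem Matrix.IsHermitian.exists_orthonormal_eigenvectors (hA : A.IsHermitian) :
    ∃ b : Fin (Fintype.card V) → V → ℝ,
      (∀ i j, b i ⬝ᵥ b j = if i = j then 1 else 0) ∧
      (∀ i, A *ᵥ b i = hA.eigenvalues₀ i • b i) ∧
      (∀ x, x = ∑ i, (b i ⬝ᵥ x) • b i) := by
  let e : Fin (Fintype.card V) ≃ V := Fintype.equivOfCardEq (Fintype.card_fin _)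
  refine ⟨fun i => ⇑(hA.eigenvectorBasis (e i)), fun i j => ?_, fun i => ?_, fun x => ?_⟩
  · have h := hA.eigenvectorBasis.inner_eq_ite (e j) (e i)
    rw [EuclideanSpace.inner_eq_star_dotProduct] at h
    simpa [eq_comm] using h
  · rw [hA.mulVec_eigenvectorBasis]
    simp [Matrix.IsHermitian.eigenvalues, e]
  · have h := hA.eigenvectorBasis.sum_repr' (WithLp.toLp 2 x)
    rw [← e.sum_comp] at h
    have h2 := congrArg WithLp.ofLp h
    simp only [WithLp.ofLp_sum, WithLp.ofLp_smul] at h2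
    rw [← h2]
    refine Finset.sum_congr rfl fun i _ => ?_
    rw [EuclideanSpace.inner_eq_star_dotProduct, h2, dotProduct_comm]
    simp

/-- Courant–Fischer, upper bound: if the quadratic form is below `C` on the span of `m` independent
vectors then so is the `i`-th eigenvalue, provided `m` exceeds the number of later indices. -/
theorem Matrix.IsHermitian.eigenvalues₀_lt_of_form_lt (hA : A.IsHermitian)
    (i : Fin (Fintype.card V)) (m : ℕ) (him : Fintype.card V ≤ i + m) (w : Fin m → V → ℝ) (C : ℝ)
    (hw : ∀ c : Fin m → ℝ, c ≠ 0 →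
      (∑ k, c k • w k) ⬝ᵥ A *ᵥ (∑ k, c k • w k) < C * ((∑ k, c k • w k) ⬝ᵥ (∑ k, c k • w k))) :
    hA.eigenvalues₀ i < C := by
  obtain ⟨b, hb, hAb, hx⟩ := hA.exists_orthonormal_eigenvectors
  let f : (Fin m → ℝ) →ₗ[ℝ] ({j : Fin (Fintype.card V) // i < j} → ℝ) :=
    { toFun := fun c j => b j ⬝ᵥ ∑ k, c k • w k
      map_add' := fun c d => by ext j; simp [add_smul, Finset.sum_add_distrib, dotProduct_add]
      map_smul' := fun r c => by
        ext j; simp [mul_smul, ← Finset.smul_sum, dotProduct_smul] }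
  have hker : LinearMap.ker f ≠ ⊥ := by
    apply LinearMap.ker_ne_bot_of_finrank_lt
    have : Fintype.card {j : Fin (Fintype.card V) // i < j} = Fintype.card V - 1 - i := by
      rw [Fintype.card_subtype, ← Fin.card_Ioi i]; congr 1; ext; simp
    simp only [Module.finrank_fintype_fun_eq_card, Fintype.card_fin, this]
    have := i.2
    omega
  obtain ⟨c, hc, hc0⟩ := (Submodule.ne_bot_iff _).1 hker
  set x := ∑ k, c k • w k with hxdef
  have hzero : ∀ j, i < j → b j ⬝ᵥ x = 0 := fun j hj => congrFun hc ⟨j, hj⟩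
  -- Independence of the `w k` is contained in `hw`: for a vanishing combination it would read `0 <
  -- 0`.
  have hform := hw c hc0
  have h1 : x ⬝ᵥ x = ∑ j, (b j ⬝ᵥ x) ^ 2 := by
    conv_lhs => enter [1]; rw [hx x]
    simp [sum_dotProduct, smul_dotProduct, sq]
  have h2 : x ⬝ᵥ A *ᵥ x = ∑ j, hA.eigenvalues₀ j * (b j ⬝ᵥ x) ^ 2 := by
    conv_lhs => enter [2, 2]; rw [hx x]
    simp only [mulVec_sum, mulVec_smul, hAb, dotProduct_sum, dotProduct_smul, smul_eq_mul]
    refine Finset.sum_congr rfl fun j _ => ?_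
    rw [dotProduct_comm x]; ring
  have h3 : hA.eigenvalues₀ i * (x ⬝ᵥ x) ≤ x ⬝ᵥ A *ᵥ x := by
    rw [h1, h2, Finset.mul_sum]
    refine Finset.sum_le_sum fun j _ => ?_
    by_cases hj : i < j
    · simp [hzero j hj]
    · exact mul_le_mul_of_nonneg_right (hA.eigenvalues₀_antitone (not_lt.1 hj)) (sq_nonneg _)
  have h4 : 0 ≤ x ⬝ᵥ x := by rw [h1]; positivity
  have h5 : hA.eigenvalues₀ i * (x ⬝ᵥ x) < C * (x ⬝ᵥ x) := h3.trans_lt hform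
  exact lt_of_mul_lt_mul_right h5 h4

/-- Courant–Fischer, lower bound: `m` linear constraints leave a vector on which the quadratic form
is at most the `i`-th eigenvalue, provided `i + m` is less than the dimension. -/
theorem Matrix.IsHermitian.exists_form_le_eigenvalues₀ (hA : A.IsHermitian)
    (i : Fin (Fintype.card V)) (m : ℕ) (him : i + m < Fintype.card V) (φ : Fin m → V → ℝ) :
    ∃ x : V → ℝ, x ≠ 0 ∧ (∀ k, φ k ⬝ᵥ x = 0) ∧ x ⬝ᵥ A *ᵥ x ≤ hA.eigenvalues₀ i * (x ⬝ᵥ x) := by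
  obtain ⟨b, hb, hAb, hx⟩ := hA.exists_orthonormal_eigenvectors
  let f : ({j : Fin (Fintype.card V) // i ≤ j} → ℝ) →ₗ[ℝ] (Fin m → ℝ) :=
    { toFun := fun c k => φ k ⬝ᵥ ∑ j, c j • b j
      map_add' := fun c d => by ext j; simp [add_smul, Finset.sum_add_distrib, dotProduct_add]
      map_smul' := fun r c => by
        ext j; simp [mul_smul, ← Finset.smul_sum, dotProduct_smul] }
  have hker : LinearMap.ker f ≠ ⊥ := by
    apply LinearMap.ker_ne_bot_of_finrank_lt
    have : Fintype.card {j : Fin (Fintype.card V) // i ≤ j} = Fintype.card V - i := by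
      rw [Fintype.card_subtype, ← Fin.card_Ici i]; congr 1; ext; simp
    simp only [Module.finrank_fintype_fun_eq_card, Fintype.card_fin, this]
    omega
  obtain ⟨c, hc, hc0⟩ := (Submodule.ne_bot_iff _).1 hker
  set x := ∑ j, c j • b j with hxdef
  have hbx : ∀ j, b j ⬝ᵥ x = if h : i ≤ j then c ⟨j, h⟩ else 0 := fun j => by
    simp only [hxdef, dotProduct_sum, dotProduct_smul, hb, smul_eq_mul, mul_ite, mul_one, mul_zero]
    split_ifs with h
    · rw [Finset.sum_eq_single ⟨j, h⟩]
      · simp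
      · intro k _ hk
        rw [if_neg]
        rintro rfl
        exact hk rfl
      · simp
    · refine Finset.sum_eq_zero fun k _ => if_neg ?_
      rintro rfl
      exact h k.2
  have h1 : x ⬝ᵥ x = ∑ j, (b j ⬝ᵥ x) ^ 2 := by
    conv_lhs => enter [1]; rw [hx x]
    simp [sum_dotProduct, smul_dotProduct, sq]
  have h2 : x ⬝ᵥ A *ᵥ x = ∑ j, hA.eigenvalues₀ j * (b j ⬝ᵥ x) ^ 2 := by
    conv_lhs => enter [2, 2]; rw [hx x]
    simp only [mulVec_sum, mulVec_smul, hAb, dotProduct_sum, dotProduct_smul, smul_eq_mul]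
    refine Finset.sum_congr rfl fun j _ => ?_
    rw [dotProduct_comm x]; ring
  refine ⟨x, fun h0 => hc0 ?_, fun k => congrFun hc k, ?_⟩
  · ext j
    have := hbx j
    simpa [h0, j.2] using this.symm
  · rw [h1, h2, Finset.mul_sum]
    refine Finset.sum_le_sum fun j _ => ?_
    by_cases hj : i ≤ j
    · exact mul_le_mul_of_nonneg_right (hA.eigenvalues₀_antitone hj) (sq_nonneg _)
    · simp [hbx, hj]

theorem Matrix.IsHermitian.sum_eigenvalues₀ (hA : A.IsHermitian) :
    ∑ i, hA.eigenvalues₀ i = A.trace := by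
  rw [hA.trace_eq_sum_eigenvalues]
  simp only [Matrix.IsHermitian.eigenvalues, RCLike.ofReal_real_eq_id, id]
  exact (Equiv.sum_comp _ _).symm

theorem Matrix.IsHermitian.sum_eigenvalues₀_sq (hA : A.IsHermitian) :
    ∑ i, hA.eigenvalues₀ i ^ 2 = (A * A).trace := by
  have h : (A * A).trace = ∑ i, hA.eigenvalues i ^ 2 := by
    conv_lhs => rw [hA.spectral_theorem, ← map_mul, Unitary.conjStarAlgAut_apply, trace_mul_comm,
      ← mul_assoc]
    simp [diagonal_mul_diagonal, trace_diagonal, sq]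
  rw [h]
  simp only [Matrix.IsHermitian.eigenvalues]
  exact (Equiv.sum_comp _ (fun i => hA.eigenvalues₀ i ^ 2)).symm

end Spectral

theorem sub_three_lt_card {V : Type*} [Fintype V] {n : ℕ} (hn : Fintype.card V = n)
    (hn3 : 2 < n) : n - 3 < Fintype.card V := by omega

/-! ### The Laplacian form, its complement, and bounds for the third smallest eigenvalue -/

section LaplacianForm

theorem sum_sum_eq_two_mul_row_add {V : Type*} [DecidableEq V] (f : V → V → ℝ) (hsymm : ∀ i j, f i j = f j i)
    (hdiag : ∀ i, f i i = 0) {s : Finset V} {v : V} (hv : v ∈ s) :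
    ∑ i ∈ s, ∑ j ∈ s, f i j =
      2 * ∑ j ∈ s, f v j + ∑ i ∈ s.erase v, ∑ j ∈ s.erase v, f i j := by
  rw [← Finset.add_sum_erase s _ hv]
  have h : ∀ i ∈ s.erase v, ∑ j ∈ s, f i j = f v i + ∑ j ∈ s.erase v, f i j := fun i _ => by
    rw [← Finset.add_sum_erase s _ hv, hsymm i v]
  rw [Finset.sum_congr rfl h, Finset.sum_add_distrib, ← Finset.add_sum_erase s (f v) hv, hdiag]
  ring

variable {V : Type*} [Fintype V] [DecidableEq V] (G : SimpleGraph V) [DecidableRel G.Adj]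

/-- The Laplacian quadratic form. -/
noncomputable def lapForm (x : V → ℝ) : ℝ := x ⬝ᵥ G.lapMatrix ℝ *ᵥ x

theorem lapForm_eq_sum (x : V → ℝ) :
    lapForm G x = (∑ i, ∑ j, if G.Adj i j then (x i - x j) ^ 2 else 0) / 2 := by
  rw [lapForm, ← Matrix.toLinearMap₂'_apply', SimpleGraph.lapMatrix_toLinearMap₂']

theorem lapForm_add_const (x : V → ℝ) (t : ℝ) : lapForm G (fun i => x i + t) = lapForm G x := by
  simp [lapForm_eq_sum]

/-- Each pair of distinct vertices is an edge of exactly one of `G` and `Gᶜ`, so the two forms add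
up to that of the complete graph, `nI - J`. -/
theorem lapForm_add_lapForm_compl (x : V → ℝ) :
    lapForm G x + lapForm Gᶜ x = Fintype.card V * ∑ i, x i ^ 2 - (∑ i, x i) ^ 2 := by
  have h : lapForm G x + lapForm Gᶜ x = (∑ i, ∑ j, (x i - x j) ^ 2) / 2 := by
    rw [lapForm_eq_sum, lapForm_eq_sum, ← add_div, ← Finset.sum_add_distrib]
    congr 1
    refine Finset.sum_congr rfl fun i _ => ?_
    rw [← Finset.sum_add_distrib]
    refine Finset.sum_congr rfl fun j _ => ?_
    by_cases hij : i = j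
    · simp [hij]
    · by_cases ha : G.Adj i j <;> simp [ha, hij]
  rw [h]
  simp only [sub_sq, Finset.sum_add_distrib, Finset.sum_sub_distrib, ← Finset.mul_sum,
    Finset.sum_const, Finset.card_univ, nsmul_eq_mul, ← Finset.sum_mul, sq (∑ i, x i), mul_assoc]
  ring

/-- All edges avoiding both `u` and `v` are dropped. Erasing `u` from the second star keeps a
possible edge `uv` from being counted twice. -/
theorem sum_star_le_lapForm (x : V → ℝ) {u v : V} (huv : u ≠ v) :
    ∑ w ∈ G.neighborFinset u, (x u - x w) ^ 2 + ∑ w ∈ (G.neighborFinset v).erase u, (x v - x w) ^ 2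
      ≤ lapForm G x := by
  set f : V → V → ℝ := fun i j => if G.Adj i j then (x i - x j) ^ 2 else 0 with hf
  have hsymm : ∀ i j, f i j = f j i := fun i j => by
    simp only [hf, G.adj_comm i j]; split_ifs <;> ring
  have hdiag : ∀ i, f i i = 0 := fun i => by simp [hf]
  have h0 : ∀ i j, 0 ≤ f i j := fun i j => by simp only [hf]; split_ifs <;> positivity
  have hu : ∑ j, f u j = ∑ w ∈ G.neighborFinset u, (x u - x w) ^ 2 := by
    rw [← Finset.sum_filter]
    exact Finset.sum_congr (by ext; simp) fun _ _ => rfl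
  have hv : ∑ j ∈ Finset.univ.erase u, f v j =
      ∑ w ∈ (G.neighborFinset v).erase u, (x v - x w) ^ 2 := by
    rw [← Finset.sum_filter]
    exact Finset.sum_congr (by ext; simp) fun _ _ => rfl
  rw [lapForm_eq_sum, le_div_iff₀ two_pos,
    sum_sum_eq_two_mul_row_add f hsymm hdiag (Finset.mem_univ u),
    sum_sum_eq_two_mul_row_add f hsymm hdiag (Finset.mem_erase.2 ⟨huv.symm, Finset.mem_univ v⟩),
    hu, hv]
  have := Finset.sum_nonneg fun i (_ : i ∈ (Finset.univ.erase u).erase v) =>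
    Finset.sum_nonneg fun j (_ : j ∈ (Finset.univ.erase u).erase v) => h0 i j
  linarith

theorem lapForm_add (x y : V → ℝ) :
    lapForm G (x + y) = lapForm G x + 2 * (x ⬝ᵥ G.lapMatrix ℝ *ᵥ y) + lapForm G y := by
  have h : y ⬝ᵥ G.lapMatrix ℝ *ᵥ x = x ⬝ᵥ G.lapMatrix ℝ *ᵥ y := by
    rw [dotProduct_mulVec, ← mulVec_transpose, (G.isSymm_lapMatrix (R := ℝ)).eq, dotProduct_comm]
  simp only [lapForm, mulVec_add, add_dotProduct, dotProduct_add, h]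
  ring

theorem lapForm_single (u : V) (a : ℝ) : lapForm G (Pi.single u a) = G.degree u * a ^ 2 := by
  simp [lapForm, SimpleGraph.lapMatrix, SimpleGraph.degMatrix]
  ring

theorem single_dotProduct_lapMatrix_single {u v : V} (huv : u ≠ v) (a b : ℝ) :
    Pi.single u a ⬝ᵥ G.lapMatrix ℝ *ᵥ Pi.single v b = -((if G.Adj u v then 1 else 0) * a * b) := by
  by_cases h : G.Adj u v <;>
    simp [SimpleGraph.lapMatrix, SimpleGraph.degMatrix, huv, h, mul_comm]

theorem lapForm_single_add_single {u v : V} (huv : u ≠ v) (a b : ℝ) :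
    lapForm G (Pi.single u a + Pi.single v b) =
      G.degree u * a ^ 2 + G.degree v * b ^ 2 - 2 * (if G.Adj u v then 1 else 0) * a * b := by
  rw [lapForm_add, lapForm_single, lapForm_single, single_dotProduct_lapMatrix_single G huv]
  ring

theorem lapForm_single_add_single_add_single {u v w : V} (huv : u ≠ v) (huw : u ≠ w) (hvw : v ≠ w)
    (a b c : ℝ) :
    lapForm G (Pi.single u a + Pi.single v b + Pi.single w c) =
      G.degree u * a ^ 2 + G.degree v * b ^ 2 + G.degree w * c ^ 2
        - 2 * (if G.Adj u v then 1 else 0) * a * b - 2 * (if G.Adj u w then 1 else 0) * a * c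
        - 2 * (if G.Adj v w then 1 else 0) * b * c := by
  rw [lapForm_add, lapForm_single_add_single G huv, lapForm_single, add_dotProduct,
    single_dotProduct_lapMatrix_single G huw, single_dotProduct_lapMatrix_single G hvw]
  ring

theorem sum_sq_single_add_single {u v : V} (huv : u ≠ v) (a b : ℝ) :
    ∑ i, (Pi.single u a + Pi.single v b : V → ℝ) i ^ 2 = a ^ 2 + b ^ 2 := by
  have : ∀ i, (Pi.single u a + Pi.single v b : V → ℝ) i ^ 2 =
      (Pi.single u (a ^ 2) : V → ℝ) i + (Pi.single v (b ^ 2) : V → ℝ) i := fun i => by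
    by_cases h1 : i = u
    · subst h1; simp [huv]
    · by_cases h2 : i = v
      · subst h2; simp [h1]
      · simp [h1, h2]
  simp only [this, Finset.sum_add_distrib, Finset.sum_pi_single', Finset.mem_univ, if_true]

theorem sum_sq_single_add_single_add_single {u v w : V} (huv : u ≠ v) (huw : u ≠ w) (hvw : v ≠ w)
    (a b c : ℝ) :
    ∑ i, (Pi.single u a + Pi.single v b + Pi.single w c : V → ℝ) i ^ 2 =
      a ^ 2 + b ^ 2 + c ^ 2 := by
  have : ∀ i, (Pi.single u a + Pi.single v b + Pi.single w c : V → ℝ) i ^ 2 =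
      (Pi.single u a + Pi.single v b : V → ℝ) i ^ 2 + (Pi.single w (c ^ 2) : V → ℝ) i := fun i => by
    by_cases h2 : i = w
    · subst h2; simp [huw.symm, hvw.symm]
    · simp [h2]
  simp only [this, Finset.sum_add_distrib, sum_sq_single_add_single huv, Finset.sum_pi_single',
    Finset.mem_univ, if_true]

theorem lapForm_le_degree_sum (x : V → ℝ) : lapForm G x ≤ 2 * ∑ i, G.degree i * x i ^ 2 := by
  rw [lapForm_eq_sum]
  have h : ∀ i j, (if G.Adj i j then (x i - x j) ^ 2 else 0) ≤
      (if G.Adj i j then 2 * x i ^ 2 else 0) + (if G.Adj j i then 2 * x j ^ 2 else 0) := fun i j => by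
    by_cases ha : G.Adj i j
    · simp only [ha, ha.symm, if_true]; nlinarith [sq_nonneg (x i + x j)]
    · have ha' : ¬ G.Adj j i := fun h => ha h.symm
      simp [ha, ha']
  have h2 := Finset.sum_le_sum fun i (_ : i ∈ Finset.univ) =>
    Finset.sum_le_sum fun j (_ : j ∈ Finset.univ) => h i j
  simp only [Finset.sum_add_distrib] at h2
  rw [Finset.sum_comm (f := fun i j => if G.Adj j i then 2 * x j ^ 2 else 0)] at h2
  have h3 : ∀ i, (∑ j, if G.Adj i j then 2 * x i ^ 2 else 0) = 2 * (G.degree i * x i ^ 2) :=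
    fun i => by
      rw [SimpleGraph.degree_eq_sum_if_adj, Finset.sum_mul, Finset.mul_sum]
      exact Finset.sum_congr rfl fun j _ => by split_ifs <;> simp
  simp only [h3, ← Finset.mul_sum] at h2
  linarith

/-- A two-dimensional space on which the Laplacian form of the complement exceeds `c` bounds the
third smallest Laplacian eigenvalue. -/
theorem laplacianEigenvalue_lt_of_compl_form {n : ℕ} (hn : Fintype.card V = n) (hn3 : 2 < n)
    (w₁ w₂ : V → ℝ) (c : ℝ) (hc : 0 ≤ c) (hcn : c < n)
    (h : ∀ a b : ℝ, (a ≠ 0 ∨ b ≠ 0) →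
      c * ∑ i, (a * w₁ i + b * w₂ i) ^ 2 < lapForm Gᶜ (fun i => a * w₁ i + b * w₂ i)) :
    laplacianEigenvalue G ⟨n - 3, sub_three_lt_card hn hn3⟩ < n - c := by
  -- Constants lie in the kernel of the Laplacian, so adjoining them gives the third dimension. The
  -- `w` need not be orthogonal to them.
  refine (G.isHermitian_lapMatrix ℝ).eigenvalues₀_lt_of_form_lt _ 3 (by simp; omega)
    ![w₁, w₂, fun _ => 1] (n - c) fun k hk => ?_
  have hx : ∑ j, k j • (![w₁, w₂, fun _ => 1] : Fin 3 → V → ℝ) j =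
      fun i => (k 0 * w₁ i + k 1 * w₂ i) + k 2 := by
    ext i; simp [Fin.sum_univ_three]
  rw [hx]
  have hnR : (0 : ℝ) < n := by exact_mod_cast (by omega : 0 < n)
  set t := k 2 with ht
  set w : V → ℝ := fun i => k 0 * w₁ i + k 1 * w₂ i with hw
  change lapForm G (fun i => w i + t) < _
  rw [lapForm_add_const]
  have hco := lapForm_add_lapForm_compl G w
  have hdot : (fun i => w i + t) ⬝ᵥ (fun i => w i + t) =
      ∑ i, w i ^ 2 + 2 * t * ∑ i, w i + n * t ^ 2 := by
    simp only [dotProduct, Finset.mul_sum, ← hn]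
    rw [← Finset.sum_add_distrib, ← nsmul_eq_mul, ← Finset.card_univ, ← Finset.sum_const,
      ← Finset.sum_add_distrib]
    exact Finset.sum_congr rfl fun i _ => by ring
  change _ < (n - c) * ((fun i => w i + t) ⬝ᵥ (fun i => w i + t))
  rw [hdot]
  rw [hn] at hco
  by_cases h0 : k 0 ≠ 0 ∨ k 1 ≠ 0
  · have h1 := h _ _ h0
    change c * ∑ i, w i ^ 2 < lapForm Gᶜ w at h1
    set S := ∑ i, w i
    -- This is what the substitution of the complement form leaves to prove; multiplied by `n` it
    -- becomes a sum of squares with nonnegative weights.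
    have h2 : 0 ≤ S ^ 2 + (n - c) * (2 * t * S + n * t ^ 2) := by
      have : (n : ℝ) * (S ^ 2 + (n - c) * (2 * t * S + n * t ^ 2)) =
          (n - c) * (S + n * t) ^ 2 + c * S ^ 2 := by ring
      have h3 : 0 ≤ (n - c) * (S + n * t) ^ 2 + c * S ^ 2 := by
        have : 0 ≤ (n : ℝ) - c := by linarith
        positivity
      rw [← this] at h3
      exact nonneg_of_mul_nonneg_right h3 hnR
    nlinarith
  · push Not at h0
    have hw0 : w = fun _ => 0 := by ext i; simp [hw, h0]
    have ht0 : t ≠ 0 := fun h => hk (by ext j; fin_cases j <;> simp [h0, ← ht, h])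
    have : lapForm G w = 0 := by simp [hw0, lapForm_eq_sum]
    rw [this, hw0]
    have : 0 < (n : ℝ) - c := by linarith
    simp only [Finset.sum_const_zero, mul_zero]
    positivity

theorem laplacianEigenvalue_le_of_compl_form {n : ℕ} (hn : Fintype.card V = n) (hn3 : 2 < n)
    (w₁ w₂ : V → ℝ) (c : ℝ) (hc : 0 < c) (hcn : c ≤ n)
    (hw : ∀ a b : ℝ, (a ≠ 0 ∨ b ≠ 0) → 0 < ∑ i, (a * w₁ i + b * w₂ i) ^ 2)
    (h : ∀ a b : ℝ,
      c * ∑ i, (a * w₁ i + b * w₂ i) ^ 2 ≤ lapForm Gᶜ (fun i => a * w₁ i + b * w₂ i)) :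
    laplacianEigenvalue G ⟨n - 3, sub_three_lt_card hn hn3⟩ ≤ n - c := by
  by_contra hlt
  push Not at hlt
  set l := laplacianEigenvalue G ⟨n - 3, sub_three_lt_card hn hn3⟩ with hl
  -- If `l > n - c`, the strict bound holds with the smaller constant `max 0 (n - l)` and yields `l
  -- < l`; the maximum is there because that bound needs a nonnegative constant.
  have h1 : max 0 (n - l) < c := max_lt hc (by linarith)
  have := laplacianEigenvalue_lt_of_compl_form G hn hn3 w₁ w₂ (max 0 (n - l)) (le_max_left _ _)
    (by linarith) fun a b hab =>
      (mul_lt_mul_of_pos_right h1 (hw a b hab)).trans_le (h a b)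
  have h2 := le_max_right 0 ((n : ℝ) - l)
  rw [← hl] at this
  linarith

theorem le_laplacianEigenvalue_of_form {n : ℕ} (hn : Fintype.card V = n) (hn3 : 2 < n)
    (φ₁ φ₂ : V → ℝ) (C : ℝ)
    (h : ∀ x : V → ℝ, φ₁ ⬝ᵥ x = 0 → φ₂ ⬝ᵥ x = 0 → C * ∑ i, x i ^ 2 ≤ lapForm G x) :
    C ≤ laplacianEigenvalue G ⟨n - 3, sub_three_lt_card hn hn3⟩ := by
  obtain ⟨x, hx0, hφ, hx⟩ := (G.isHermitian_lapMatrix ℝ).exists_form_le_eigenvalues₀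
    ⟨n - 3, sub_three_lt_card hn hn3⟩ 2 (by simp; omega) ![φ₁, φ₂]
  have h1 := h x (hφ 0) (hφ 1)
  have h2 : x ⬝ᵥ x = ∑ i, x i ^ 2 := by simp [dotProduct, sq]
  change lapForm G x ≤ _ at hx
  rw [h2] at hx
  have h3 : 0 < ∑ i, x i ^ 2 := by
    obtain ⟨i, hi⟩ := Function.ne_iff.1 hx0
    exact Finset.sum_pos' (fun _ _ => sq_nonneg _) ⟨i, Finset.mem_univ _, by
      have : x i ≠ 0 := hi
      positivity⟩
  exact le_of_mul_le_mul_right (h1.trans hx) h3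

end LaplacianForm

theorem quadratic_pos_of_det_pos {p q s : ℝ} (hp : 0 < p) (hdet : s ^ 2 < p * q) {a b : ℝ}
    (hab : a ≠ 0 ∨ b ≠ 0) : 0 < p * a ^ 2 + 2 * s * a * b + q * b ^ 2 := by
  have h : p * (p * a ^ 2 + 2 * s * a * b + q * b ^ 2) =
      (p * a + s * b) ^ 2 + (p * q - s ^ 2) * b ^ 2 := by ring
  refine pos_of_mul_pos_right (a := p) ?_ hp.le
  rw [h]
  by_cases hb : b = 0
  · have ha : a ≠ 0 := by tauto
    subst hb
    have : 0 < (p * a) ^ 2 := by positivity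
    simpa using this
  · have h1 : 0 < p * q - s ^ 2 := by linarith
    have h2 : 0 < (p * q - s ^ 2) * b ^ 2 := by positivity
    nlinarith [sq_nonneg (p * a + s * b)]

/-! ### Test planes from two vertices, or from a vertex and an edge, of the complement -/

section TestVectors

variable {V : Type*} [Fintype V] [DecidableEq V] (G : SimpleGraph V) [DecidableRel G.Adj]

/-- On the span of the indicators of `u` and `v` the complement form is diagonal with the two
degrees as entries. -/
theorem laplacianEigenvalue_le_of_compl_nonadj {n : ℕ} (hn : Fintype.card V = n) (hn3 : 2 < n)
    {u v : V} (huv : u ≠ v) (hadj : ¬ Gᶜ.Adj u v) {k : ℕ} (hk : 1 ≤ k)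
    (hu : k ≤ Gᶜ.degree u) (hv : k ≤ Gᶜ.degree v) :
    laplacianEigenvalue G ⟨n - 3, sub_three_lt_card hn hn3⟩ ≤ n - k := by
  have hkn : k ≤ n := hu.trans (by have := Gᶜ.degree_lt_card_verts u; omega)
  have hx : ∀ a b : ℝ, (fun i => a * (Pi.single u 1 : V → ℝ) i + b * (Pi.single v 1 : V → ℝ) i) =
      Pi.single u a + Pi.single v b := fun a b => by
    ext i; simp [Pi.single_apply]
  have hx' : ∀ a b : ℝ, ∑ i, (a * (Pi.single u 1 : V → ℝ) i + b * (Pi.single v 1 : V → ℝ) i) ^ 2 =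
      a ^ 2 + b ^ 2 := fun a b => by
    rw [← sum_sq_single_add_single huv a b, ← hx]
  refine laplacianEigenvalue_le_of_compl_form G hn hn3 (Pi.single u 1) (Pi.single v 1) k
    (by exact_mod_cast hk) (by exact_mod_cast hkn) (fun a b hab => ?_) fun a b => ?_
  · rw [hx']
    rcases hab with h | h <;> positivity
  · rw [hx', hx, lapForm_single_add_single _ huv, if_neg hadj]
    have h1 : (k : ℝ) ≤ Gᶜ.degree u := by exact_mod_cast hu
    have h2 : (k : ℝ) ≤ Gᶜ.degree v := by exact_mod_cast hv
    nlinarith [sq_nonneg a, sq_nonneg b]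

/-- With `q = k - 1`, choose `q` further neighbours `S` of `u` and `T` of `v`, possibly overlapping.
The plane is spanned by `e_u - e_v` and `q (e_u + e_v) - 1_{S ∪ T}`. The edge `uv` contributes
`4a²`, the other chosen edges `q ((q+1)b ± a)²`, so the cross terms cancel, while the squared norm
is at most `2a² + 2q(q+1)b²`. -/
theorem laplacianEigenvalue_le_of_compl_adj {n : ℕ} (hn : Fintype.card V = n) (hn3 : 2 < n)
    {u v : V} (hadj : Gᶜ.Adj u v) {k : ℕ} (hk : 2 ≤ k)
    (hu : k ≤ Gᶜ.degree u) (hv : k ≤ Gᶜ.degree v) :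
    laplacianEigenvalue G ⟨n - 3, sub_three_lt_card hn hn3⟩ ≤ n - k := by
  have hkn : k ≤ n := hu.trans (by have := Gᶜ.degree_lt_card_verts u; omega)
  obtain ⟨q, rfl⟩ : ∃ q, k = q + 1 := ⟨k - 1, by omega⟩
  have huv : u ≠ v := hadj.ne
  obtain ⟨S, hS, hSc⟩ : ∃ S ⊆ (Gᶜ.neighborFinset u).erase v, S.card = q := by
    apply Finset.exists_subset_card_eq
    rw [Finset.card_erase_of_mem (by simpa using hadj), SimpleGraph.card_neighborFinset_eq_degree]
    omega
  obtain ⟨T, hT, hTc⟩ : ∃ T ⊆ (Gᶜ.neighborFinset v).erase u, T.card = q := by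
    apply Finset.exists_subset_card_eq
    rw [Finset.card_erase_of_mem (by simpa using hadj.symm),
      SimpleGraph.card_neighborFinset_eq_degree]
    omega
  have huS : u ∉ S := fun h => by simpa using hS h
  have hvS : v ∉ S := fun h => by simpa using hS h
  have huT : u ∉ T := fun h => by simpa using hT h
  have hvT : v ∉ T := fun h => by simpa using hT h
  set w₁ : V → ℝ := fun i => if i = u then 1 else if i = v then -1 else 0 with hw₁
  set w₂ : V → ℝ := fun i => if i = u then q else if i = v then q else
    if i ∈ S ∪ T then -1 else 0 with hw₂
  have hxu : ∀ a b : ℝ, a * w₁ u + b * w₂ u = a + q * b := fun a b => by simp [hw₁, hw₂]; ring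
  have hxv : ∀ a b : ℝ, a * w₁ v + b * w₂ v = -a + q * b := fun a b => by
    simp [hw₁, hw₂, huv.symm]; ring
  have hxw : ∀ a b : ℝ, ∀ i ∈ S ∪ T, a * w₁ i + b * w₂ i = -b := fun a b i hi => by
    have h1 : i ≠ u := by rintro rfl; simp_all
    have h2 : i ≠ v := by rintro rfl; simp_all
    simp only [hw₁, hw₂, if_neg h1, if_neg h2, if_pos hi]; ring
  have hx0 : ∀ a b : ℝ, ∀ i, i ≠ u → i ≠ v → i ∉ S ∪ T → a * w₁ i + b * w₂ i = 0 :=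
    fun a b i h1 h2 h3 => by simp only [hw₁, hw₂, if_neg h1, if_neg h2, if_neg h3]; ring
  have hnorm : ∀ a b : ℝ, ∑ i, (a * w₁ i + b * w₂ i) ^ 2 =
      (a + q * b) ^ 2 + (-a + q * b) ^ 2 + (S ∪ T).card * b ^ 2 := fun a b => by
    rw [← Finset.add_sum_erase _ _ (Finset.mem_univ u),
      ← Finset.add_sum_erase _ _ (Finset.mem_erase.2 ⟨huv.symm, Finset.mem_univ v⟩), hxu, hxv,
      ← Finset.sum_subset (s₁ := S ∪ T)]
    · rw [Finset.sum_congr rfl fun i hi => by rw [hxw a b i hi]]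
      simp; ring
    · intro i hi
      have h1 : i ≠ u := by rintro rfl; simp_all
      have h2 : i ≠ v := by rintro rfl; simp_all
      simp [h1, h2]
    · intro i hi hi'
      simp only [Finset.mem_erase, Finset.mem_univ, and_true] at hi
      rw [hx0 a b i hi.2 hi.1 hi']; simp
  have hq : (1 : ℝ) ≤ q := by exact_mod_cast (by omega : 1 ≤ q)
  refine laplacianEigenvalue_le_of_compl_form G hn hn3 w₁ w₂ _
    (by positivity) (by exact_mod_cast hkn) (fun a b hab => ?_) fun a b => ?_
  · rw [hnorm]
    by_contra hle
    have h3 : 0 ≤ ((S ∪ T).card : ℝ) * b ^ 2 := mul_nonneg (Nat.cast_nonneg _) (sq_nonneg _)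
    have h4 : a ^ 2 + (q * b) ^ 2 ≤ 0 := by nlinarith
    have h0 : a = 0 ∧ q * b = 0 :=
      ⟨pow_eq_zero_iff two_ne_zero |>.1 (by nlinarith [sq_nonneg a, sq_nonneg (q * b)]),
        pow_eq_zero_iff two_ne_zero |>.1 (by nlinarith [sq_nonneg a, sq_nonneg (q * b)])⟩
    have hb : b = 0 := by
      rcases mul_eq_zero.1 h0.2 with h | h
      · linarith
      · exact h
    tauto
  · rw [hnorm]
    refine le_trans ?_ (sum_star_le_lapForm Gᶜ _ huv)
    have h1 : 4 * a ^ 2 + q * (a + (q + 1) * b) ^ 2 ≤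
        ∑ w ∈ Gᶜ.neighborFinset u, (a * w₁ u + b * w₂ u - (a * w₁ w + b * w₂ w)) ^ 2 := by
      rw [← Finset.add_sum_erase _ _ (by simpa using hadj : v ∈ Gᶜ.neighborFinset u)]
      refine add_le_add (le_of_eq ?_) ?_
      · rw [hxu, hxv]; ring
      · refine le_trans (le_of_eq ?_)
          (Finset.sum_le_sum_of_subset_of_nonneg hS fun _ _ _ => sq_nonneg _)
        rw [Finset.sum_congr rfl fun i hi => by rw [hxu, hxw a b i (Finset.mem_union_left _ hi)]]
        simp only [Finset.sum_const, hSc, nsmul_eq_mul]; ring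
    have h2 : q * (-a + (q + 1) * b) ^ 2 ≤
        ∑ w ∈ (Gᶜ.neighborFinset v).erase u,
          (a * w₁ v + b * w₂ v - (a * w₁ w + b * w₂ w)) ^ 2 := by
      refine le_trans (le_of_eq ?_)
        (Finset.sum_le_sum_of_subset_of_nonneg hT fun _ _ _ => sq_nonneg _)
      rw [Finset.sum_congr rfl fun i hi => by rw [hxv, hxw a b i (Finset.mem_union_right _ hi)]]
      simp only [Finset.sum_const, hTc, nsmul_eq_mul]; ring
    refine le_trans ?_ (add_le_add h1 h2)
    have hcard : ((S ∪ T).card : ℝ) ≤ 2 * q := by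
      have := Finset.card_union_le S T
      exact_mod_cast (by omega : (S ∪ T).card ≤ 2 * q)
    have h3 : ((S ∪ T).card : ℝ) * b ^ 2 ≤ 2 * q * b ^ 2 :=
      mul_le_mul_of_nonneg_right hcard (sq_nonneg b)
    push_cast
    have h4 := mul_le_mul_of_nonneg_left h3 (by positivity : (0 : ℝ) ≤ q + 1)
    nlinarith [sq_nonneg a]

/-- The plane is spanned by `e_u` and `e_a - e_b`. The edge `ab` raises the Rayleigh quotient of the
second vector to `k + 1`, and the off-diagonal entry `s` is `0` or `±1`. The hypothesis `hc` bounds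
the excess of `c` over `k`. -/
theorem laplacianEigenvalue_lt_of_compl_edge {n : ℕ} (hn : Fintype.card V = n) (hn3 : 2 < n)
    {u a b : V} (hua : u ≠ a) (hub : u ≠ b) (hab : Gᶜ.Adj a b) {k : ℕ}
    (ha : Gᶜ.degree a = k) (hb : Gᶜ.degree b = k) (hku : k < Gᶜ.degree u)
    {c : ℝ} (hkc : k ≤ c) (hc : n * (c - k) ≤ Gᶜ.degree u - k) :
    laplacianEigenvalue G ⟨n - 3, sub_three_lt_card hn hn3⟩ < n - c := by
  have hDn : Gᶜ.degree u + 1 ≤ n := by have := Gᶜ.degree_lt_card_verts u; omega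
  have hk1 : 1 ≤ k := by
    rw [← ha, Nat.one_le_iff_ne_zero, ← Nat.pos_iff_ne_zero, SimpleGraph.degree_pos_iff_exists_adj]
    exact ⟨b, hab⟩
  set D := Gᶜ.degree u with hD
  have hDnR : (D : ℝ) + 1 ≤ n := by exact_mod_cast hDn
  have hkD : (k : ℝ) + 1 ≤ D := by exact_mod_cast hku
  have hk1R : (1 : ℝ) ≤ k := by exact_mod_cast hk1
  have hnR : (3 : ℝ) ≤ n := by exact_mod_cast hn3
  have hcn : c < n := by nlinarith
  set s : ℝ := -(if Gᶜ.Adj u a then 1 else 0) + (if Gᶜ.Adj u b then 1 else 0) with hs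
  -- A nonzero `s` means that `u` is adjacent to exactly one of `a`, `b`; that vertex then has two
  -- neighbours, so `k ≥ 2`.
  have hs1 : s = 0 ∨ (s ^ 2 = 1 ∧ 2 ≤ k) := by
    have h2 : ∀ x y : V, u ≠ y → Gᶜ.Adj u x → Gᶜ.Adj x y → 2 ≤ Gᶜ.degree x := fun x y hy hx hxy => by
      rw [← SimpleGraph.card_neighborFinset_eq_degree, ← Finset.card_pair hy]
      refine Finset.card_le_card fun z hz => ?_
      simp only [Finset.mem_insert, Finset.mem_singleton] at hz
      rcases hz with rfl | rfl
      · simpa using hx.symm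
      · simpa using hxy
    by_cases h1 : Gᶜ.Adj u a
    · have := h2 a b hub h1 hab
      rw [ha] at this
      by_cases h3 : Gᶜ.Adj u b
      · left; rw [hs, if_pos h1, if_pos h3]; norm_num
      · right; rw [hs, if_pos h1, if_neg h3]; norm_num; exact this
    · by_cases h3 : Gᶜ.Adj u b
      · have := h2 b a hua h3 hab.symm
        rw [hb] at this
        right; rw [hs, if_neg h1, if_pos h3]; norm_num; exact this
      · left; rw [hs, if_neg h1, if_neg h3]; norm_num
  have hdelta : (n : ℝ) * (c - k) ≤ n - 1 - k := by linarith
  have hp : 0 < D - c := by nlinarith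
  have hdet : s ^ 2 < (D - c) * (2 * k + 2 - 2 * c) := by
    have hq : 0 < 1 - (c - k) := by nlinarith
    rcases hs1 with h | ⟨h, h2⟩
    · rw [h]
      have : 0 < (D - c) * (2 * (1 - (c - k))) := by positivity
      linarith
    · rw [h]
      have h2R : (2 : ℝ) ≤ k := by exact_mod_cast h2
      -- After multiplication by `n²` the determinant is at least `2(n-1) j(n-j)`, and `j(n-j) ≥ n -
      -- 1` since `1 ≤ j ≤ n - 1`. Finally `2(n-1)² > n²` because `k ≥ 2` forces `n ≥ 4`.
      set j : ℝ := D - k with hj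
      have hj1 : 1 ≤ j := by linarith
      have hjn : j ≤ n - 1 - k := by linarith
      have e1 : (n - 1) * j ≤ n * (D - c) := by
        have : n * (D - c) = n * j - n * (c - k) := by rw [hj]; ring
        linarith
      have e2 : n - j ≤ n * (1 - (c - k)) := by linarith
      have e3 : ((n : ℝ) - 1) * j * (n - j) ≤ n * (D - c) * (n * (1 - (c - k))) :=
        mul_le_mul e1 e2 (by linarith) (by positivity)
      have e4 : (n : ℝ) - 1 ≤ j * (n - j) := by nlinarith
      have e5 : ((n : ℝ) - 1) * (n - 1) ≤ (n - 1) * (j * (n - j)) :=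
        mul_le_mul_of_nonneg_left e4 (by linarith)
      have e6 : (n : ℝ) ^ 2 < 2 * ((n - 1) * (n - 1)) := by nlinarith
      have e7 : (n : ℝ) ^ 2 * 1 < n ^ 2 * ((D - c) * (2 * k + 2 - 2 * c)) := by nlinarith
      exact lt_of_mul_lt_mul_left e7 (by positivity)
  have hx : ∀ x y : ℝ, (fun i => x * (Pi.single u 1 : V → ℝ) i +
      y * (Pi.single a 1 + Pi.single b (-1) : V → ℝ) i) =
      Pi.single u x + Pi.single a y + Pi.single b (-y) := fun x y => by
    ext i
    simp only [Pi.add_apply, Pi.single_apply]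
    split_ifs <;> ring
  refine laplacianEigenvalue_lt_of_compl_form G hn hn3 (Pi.single u 1)
    (Pi.single a 1 + Pi.single b (-1)) c (by linarith) hcn fun x y hxy => ?_
  have hnorm := sum_sq_single_add_single_add_single hua hub hab.ne x y (-y)
  rw [← hx] at hnorm
  rw [hx, hnorm, lapForm_single_add_single_add_single _ hua hub hab.ne, ha, hb, if_pos hab]
  have := quadratic_pos_of_det_pos hp hdet hxy
  rw [hs] at this
  linarith

end TestVectors

/-! ### Test plane from a vertex and a star of the complement -/

section StarVectors

variable {V : Type*} [Fintype V] [DecidableEq V] (G : SimpleGraph V) [DecidableRel G.Adj]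

/-- The plane is spanned by `e_u` and `r e_a - 1_B`, where `B` consists of the `r` neighbours of `a`
other than `u`. Only edges at `u` or `a` are kept; `hdet` says that the resulting form minus `c‖x‖²`
has positive determinant. -/
theorem laplacianEigenvalue_lt_of_compl_star {n : ℕ} (hn : Fintype.card V = n) (hn3 : 2 < n)
    {u a : V} (hua : u ≠ a) {r t ε c : ℝ}
    (hr : r = ((Gᶜ.neighborFinset a).erase u).card)
    (ht : t = (Gᶜ.neighborFinset u ∩ (Gᶜ.neighborFinset a).erase u).card)
    (hε : ε = if Gᶜ.Adj u a then 1 else 0) (hc : 0 ≤ c) (hcn : c < n) (hcu : c < Gᶜ.degree u)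
    (hdet : (t - ε * r) ^ 2 <
      (Gᶜ.degree u - c) * (ε * r ^ 2 + t + r * (r + 1) ^ 2 - c * (r ^ 2 + r))) :
    laplacianEigenvalue G ⟨n - 3, sub_three_lt_card hn hn3⟩ < n - c := by
  set B := (Gᶜ.neighborFinset a).erase u with hB
  have huB : u ∉ B := by simp [hB]
  have haB : a ∉ B := by simp [hB]
  set w₂ : V → ℝ := fun i => (if i = a then r else 0) + (if i ∈ B then -1 else 0) with hw₂
  set w₁ : V → ℝ := Pi.single u 1 with hw₁
  have hwu : w₂ u = 0 := by simp [hw₂, hua, huB]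
  have hwa : w₂ a = r := by simp [hw₂, haB]
  have hwB : ∀ i ∈ B, w₂ i = -1 := fun i hi => by
    have : i ≠ a := by rintro rfl; exact haB hi
    simp [hw₂, this, hi]
  have hu1 : ∀ i, i ≠ u → w₁ i = 0 := fun i hi => by simp [hw₁, hi]
  have huu : w₁ u = 1 := by simp [hw₁]
  have hsq : ∀ i, w₂ i ^ 2 = (if i = a then r ^ 2 else 0) + (if i ∈ B then 1 else 0) := fun i => by
    by_cases hi : i ∈ B
    · have : i ≠ a := by rintro rfl; exact haB hi
      simp [hwB i hi, this, hi]
    · by_cases h2 : i = a <;> simp [hw₂, h2, hi, haB]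
  have hnorm : ∀ x y : ℝ, ∑ i, (x * w₁ i + y * w₂ i) ^ 2 = x ^ 2 + (r ^ 2 + r) * y ^ 2 :=
    fun x y => by
      have h1 : ∀ i, (x * w₁ i + y * w₂ i) ^ 2 =
          (if i = u then x ^ 2 else 0) + y ^ 2 * w₂ i ^ 2 := fun i => by
        by_cases hi : i = u
        · subst hi; simp [hwu, huu]
        · simp [hu1 i hi, hi]; ring
      simp only [h1, hsq, Finset.sum_add_distrib, ← Finset.mul_sum, Finset.sum_ite_eq',
        Finset.mem_univ, if_true, Finset.sum_ite_mem, Finset.univ_inter, Finset.sum_const,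
        nsmul_eq_mul, ← hr]
      ring
  refine laplacianEigenvalue_lt_of_compl_form G hn hn3 w₁ w₂ c hc hcn fun x y hxy => ?_
  rw [hnorm]
  refine lt_of_lt_of_le ?_ (sum_star_le_lapForm Gᶜ _ hua)
  have h1 : ∑ w ∈ Gᶜ.neighborFinset u, (x * w₁ u + y * w₂ u - (x * w₁ w + y * w₂ w)) ^ 2 =
      Gᶜ.degree u * x ^ 2 + 2 * (t - ε * r) * x * y + (ε * r ^ 2 + t) * y ^ 2 := by
    have h2 : ∀ w ∈ Gᶜ.neighborFinset u, (x * w₁ u + y * w₂ u - (x * w₁ w + y * w₂ w)) ^ 2 =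
        x ^ 2 - 2 * x * y * w₂ w + y ^ 2 * w₂ w ^ 2 := fun w hw => by
      have : w ≠ u := by rintro rfl; simp at hw
      rw [hu1 w this, huu, hwu]; ring
    rw [Finset.sum_congr rfl h2]
    simp only [hsq, Finset.sum_add_distrib, Finset.sum_sub_distrib, ← Finset.mul_sum]
    simp only [hw₂, Finset.sum_add_distrib, Finset.sum_ite_eq', Finset.sum_ite_mem,
      Finset.sum_const, SimpleGraph.card_neighborFinset_eq_degree, nsmul_eq_mul, ← ht,
      SimpleGraph.mem_neighborFinset, hε]
    split_ifs <;> ring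
  have h3 : ∑ w ∈ B, (x * w₁ a + y * w₂ a - (x * w₁ w + y * w₂ w)) ^ 2 =
      r * (r + 1) ^ 2 * y ^ 2 := by
    have h4 : ∀ w ∈ B, (x * w₁ a + y * w₂ a - (x * w₁ w + y * w₂ w)) ^ 2 =
        (r + 1) ^ 2 * y ^ 2 := fun w hw => by
      have : w ≠ u := by rintro rfl; exact huB hw
      rw [hu1 w this, hu1 a hua.symm, hwB w hw, hwa]; ring
    rw [Finset.sum_congr rfl h4, Finset.sum_const, nsmul_eq_mul, ← hr]; ring
  rw [h1, h3]
  have := quadratic_pos_of_det_pos (by linarith : 0 < (Gᶜ.degree u : ℝ) - c) hdet hxy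
  linarith

end StarVectors

/-! ### Determinant inequalities for the star plane -/

section StarArithmetic

/-- The case `ε = 0`, `r = k` of the star determinant, with `c = k + δ` and `p = D - c`. It suffices
that `δ ≤ 1/2`, `p ≥ (k+1)/2` and `t² ≤ tk`. -/
theorem star_det_of_nonadj {n k p δ t : ℝ} (hk : 2 ≤ k) (hkn : k + 2 ≤ n) (hδ : 0 ≤ δ)
    (hδn : n * δ ≤ (n - 1) / 2 - k) (hp : (n - 1) / 2 + (n - 1) * δ ≤ p) (ht : 0 ≤ t)
    (htk : t ≤ k) : t ^ 2 < p * (t + k * (k + 1) * (1 - δ)) := by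
  have h1 : δ ≤ 1 / 2 := by nlinarith
  have h2 : (k + 1) / 2 ≤ p := by nlinarith
  have h3 : t + k * (k + 1) / 2 ≤ t + k * (k + 1) * (1 - δ) := by
    have : 0 ≤ k * (k + 1) * (1 / 2 - δ) := mul_nonneg (by positivity) (by linarith)
    linarith
  have h4 : (k + 1) / 2 * (t + k * (k + 1) / 2) ≤ p * (t + k * (k + 1) * (1 - δ)) :=
    mul_le_mul h2 h3 (by positivity) (by linarith)
  refine lt_of_lt_of_le ?_ h4
  have h5 : t ^ 2 ≤ t * k := by nlinarith
  have h6 : t * k ≤ k * k := by nlinarith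
  nlinarith

/-- The case `ε = 1`, `r = k - 1`. Multiplied by `n`, the last factor is at least `r(r+1)(r+3/2) >
3r²`, and `p ≥ (n-1)/2`, while `(t-r)² ≤ r²`. -/
theorem star_det_of_adj {n r p δ t : ℝ} (hr : 1 ≤ r) (hrn : r + 3 ≤ n) (hδ : 0 ≤ δ)
    (hδn : n * δ ≤ (n - 1) / 2 - (r + 1)) (hp : (n - 1) / 2 + (n - 1) * δ ≤ p) (ht : 0 ≤ t)
    (htr : t ≤ r) : (t - r) ^ 2 < p * (r ^ 2 + t - δ * (r * (r + 1))) := by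
  have hn : 0 < n := by linarith
  have h1 : (n - 1) / 2 ≤ p := by nlinarith
  have h0 : 0 ≤ r * (r + 1) := by positivity
  have h2 : r * (r + 1) * (r + 3 / 2) ≤ n * (r ^ 2 + t - δ * (r * (r + 1))) := by
    have h3 := mul_le_mul_of_nonneg_right hδn h0
    have h4 : r * (r + 1) ≤ 2 * r ^ 2 := by nlinarith
    have h5 : n * (r * (r + 1)) ≤ n * (2 * r ^ 2) := mul_le_mul_of_nonneg_left h4 hn.le
    have h6 : 0 ≤ n * t := by positivity
    nlinarith
  have h7 : 3 * r ^ 2 < r * (r + 1) * (r + 3 / 2) := by nlinarith [sq_nonneg (r - 1)]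
  have h8 : (n - 1) / 2 * (3 * r ^ 2) < p * (n * (r ^ 2 + t - δ * (r * (r + 1)))) :=
    mul_lt_mul' h1 (h7.trans_le h2) (by positivity) (by linarith)
  have h9 : (t - r) ^ 2 ≤ r ^ 2 := by nlinarith
  have h10 : n * r ^ 2 ≤ (n - 1) / 2 * (3 * r ^ 2) := by nlinarith [sq_nonneg r]
  have h11 : n * (t - r) ^ 2 ≤ n * r ^ 2 := mul_le_mul_of_nonneg_left h9 hn.le
  have h12 : n * (t - r) ^ 2 < n * (p * (r ^ 2 + t - δ * (r * (r + 1)))) := by linarith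
  exact lt_of_mul_lt_mul_left h12 hn.le

end StarArithmetic

/-! ### No edge between vertices of second largest degree -/

section IndependentMaximal

variable {V : Type*} [Fintype V] [DecidableEq V]

/-- Double counting between the vertices `K` of degree `k` and the remaining ones `X`, all other
than `u`: each vertex of `K` has at least `k - 1` neighbours in `X`, and each vertex of `X` has
degree at most `k - 1`. As `k ≥ 2`, this gives `|K| ≤ |X|`, so at least half of the vertices other
than `u` fall short of `k`. -/
theorem sum_degree_add_card_le {H : SimpleGraph V} [DecidableRel H.Adj] {u : V} {k : ℕ}
    (hk : ∀ w, w ≠ u → H.degree w ≤ k)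
    (hind : ∀ a b, a ≠ u → b ≠ u → H.degree a = k → H.degree b = k → ¬ H.Adj a b) (hk2 : 2 ≤ k) :
    2 * (∑ w, H.degree w) + (Fintype.card V - 1) ≤
      2 * H.degree u + 2 * (k * (Fintype.card V - 1)) := by
  set K := (Finset.univ.erase u).filter fun w => H.degree w = k with hK
  set X := (Finset.univ.erase u).filter fun w => ¬ H.degree w = k with hX
  have hcard : K.card + X.card = Fintype.card V - 1 := by
    rw [Finset.card_filter_add_card_filter_not, Finset.card_erase_of_mem (Finset.mem_univ u),
      Finset.card_univ]
  have hsum : ∑ w, H.degree w = H.degree u + k * K.card + ∑ w ∈ X, H.degree w := by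
    rw [← Finset.add_sum_erase _ _ (Finset.mem_univ u),
      ← Finset.sum_filter_add_sum_filter_not _ (fun w => H.degree w = k), ← hK, ← hX,
      Finset.sum_congr rfl fun w (hw : w ∈ K) => (Finset.mem_filter.1 hw).2]
    simp; ring
  have hXle : ∑ w ∈ X, H.degree w ≤ (k - 1) * X.card := by
    rw [mul_comm, ← smul_eq_mul]
    refine Finset.sum_le_card_nsmul _ _ _ fun w hw => ?_
    have h1 := Finset.mem_filter.1 hw
    have := hk w (Finset.ne_of_mem_erase h1.1)
    have := h1.2
    omega
  have hKX : (k - 1) * K.card ≤ ∑ w ∈ X, H.degree w := by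
    have h1 := Finset.sum_card_bipartiteAbove_eq_sum_card_bipartiteBelow (s := K) (t := X) H.Adj
    have h2 : ∀ a ∈ K, k - 1 ≤ (X.bipartiteAbove H.Adj a).card := fun a ha => by
      have ha' := Finset.mem_filter.1 ha
      have h3 : (H.neighborFinset a).erase u ⊆ X.bipartiteAbove H.Adj a := fun b hb => by
        have hb' := Finset.mem_erase.1 hb
        have hab : H.Adj a b := by simpa using hb'.2
        simp only [Finset.bipartiteAbove, Finset.mem_filter, hX, Finset.mem_erase,
          Finset.mem_univ, and_true]
        exact ⟨⟨hb'.1, fun h => hind a b (Finset.ne_of_mem_erase ha'.1) hb'.1 ha'.2 h hab⟩, hab⟩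
      have h4 := Finset.card_le_card h3
      have h5 := Finset.pred_card_le_card_erase (s := H.neighborFinset a) (a := u)
      rw [SimpleGraph.card_neighborFinset_eq_degree, ha'.2] at h5
      omega
    have h6 : ∀ b ∈ X, (K.bipartiteBelow H.Adj b).card ≤ H.degree b := fun b _ => by
      rw [← SimpleGraph.card_neighborFinset_eq_degree]
      refine Finset.card_le_card fun a ha => ?_
      simpa using (Finset.mem_filter.1 ha).2.symm
    calc (k - 1) * K.card = K.card • (k - 1) := by rw [smul_eq_mul, mul_comm]
      _ ≤ _ := Finset.card_nsmul_le_sum _ _ _ h2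
      _ = _ := h1
      _ ≤ _ := Finset.sum_le_sum h6
  have hKleX : K.card ≤ X.card :=
    Nat.le_of_mul_le_mul_left (hKX.trans hXle) (by omega)
  rw [hsum, ← hcard]
  obtain ⟨q, rfl⟩ : ∃ q, k = q + 1 := ⟨k - 1, by omega⟩
  simp only [Nat.add_sub_cancel] at hXle
  nlinarith

variable (G : SimpleGraph V) [DecidableRel G.Adj]

/-- With `c = k + δ` the degree count becomes `(n-1)/2 + nδ ≤ D - k`. Hence `D - c` is large and `δ`
is small, as the star determinant requires. -/
theorem laplacianEigenvalue_lt_of_compl_independent {n : ℕ} (hn : Fintype.card V = n) (hn3 : 2 < n)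
    {u a : V} (hua : u ≠ a) {k : ℕ} (ha : Gᶜ.degree a = k) (hk : ∀ w, w ≠ u → Gᶜ.degree w ≤ k)
    (hind : ∀ a b, a ≠ u → b ≠ u → Gᶜ.degree a = k → Gᶜ.degree b = k → ¬ Gᶜ.Adj a b)
    (hk2 : 2 ≤ k) (hku : k < Gᶜ.degree u) {c : ℝ} (hkc : k ≤ c)
    (hc : n * c = ∑ w, (Gᶜ.degree w : ℝ)) :
    laplacianEigenvalue G ⟨n - 3, sub_three_lt_card hn hn3⟩ < n - c := by
  have hDn : Gᶜ.degree u + 1 ≤ n := by have := Gᶜ.degree_lt_card_verts u; omega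
  have hcount := sum_degree_add_card_le hk hind hk2
  rw [hn] at hcount
  have hcountR : 2 * (∑ w, (Gᶜ.degree w : ℝ)) + (n - 1) ≤
      2 * Gᶜ.degree u + 2 * (k * (n - 1)) := by
    have : ((n - 1 : ℕ) : ℝ) = n - 1 := by push_cast [(by omega : 1 ≤ n)]; ring
    rw [← this]
    exact_mod_cast hcount
  rw [← hc] at hcountR
  set D := Gᶜ.degree u with hD
  have hDnR : (D : ℝ) + 1 ≤ n := by exact_mod_cast hDn
  have hkD : (k : ℝ) + 1 ≤ D := by exact_mod_cast hku
  have hk2R : (2 : ℝ) ≤ k := by exact_mod_cast hk2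
  obtain ⟨δ, rfl⟩ : ∃ δ, c = k + δ := ⟨c - k, by ring⟩
  have hδ : 0 ≤ δ := by linarith
  have hj : (n - 1) / 2 + n * δ ≤ D - k := by linarith
  have hδn : n * δ ≤ (n - 1) / 2 - k := by linarith
  have hp : (n - 1 : ℝ) / 2 + (n - 1) * δ ≤ D - (k + δ) := by linarith
  have hn1 : (0 : ℝ) ≤ (n - 1) * δ := mul_nonneg (by linarith) hδ
  have hcD : (k : ℝ) + δ < D := by linarith
  set B := (Gᶜ.neighborFinset a).erase u with hB
  have ht : ((Gᶜ.neighborFinset u ∩ B).card : ℝ) ≤ B.card := by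
    exact_mod_cast Finset.card_le_card Finset.inter_subset_right
  refine laplacianEigenvalue_lt_of_compl_star G hn hn3 hua rfl rfl rfl (by linarith)
    (by linarith) hcD ?_
  rw [← hB, ← hD]
  by_cases hadj : Gᶜ.Adj u a
  · have hBc : (B.card : ℝ) + 1 = k := by
      have : B.card + 1 = k := by
        rw [hB, Finset.card_erase_add_one (by simpa using hadj.symm),
          SimpleGraph.card_neighborFinset_eq_degree, ha]
      exact_mod_cast this
    have := star_det_of_adj (n := n) (r := B.card) (p := D - (k + δ)) (δ := δ) (by linarith)
      (by linarith) hδ (by linarith) hp (Nat.cast_nonneg _) ht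
    rw [if_pos hadj, one_mul]
    refine this.trans_eq ?_
    rw [← hBc]; ring
  · have hBc : (B.card : ℝ) = k := by
      have : B.card = k := by
        rw [hB, Finset.erase_eq_of_notMem fun h => hadj ((Gᶜ.mem_neighborFinset a u).1 h).symm,
          SimpleGraph.card_neighborFinset_eq_degree, ha]
      exact_mod_cast this
    rw [hBc] at ht ⊢
    have := star_det_of_nonadj (n := n) (k := k) (p := D - (k + δ)) (δ := δ) hk2R
      (by linarith) hδ (by linarith) hp (Nat.cast_nonneg _) ht
    rw [if_neg hadj, zero_mul, sub_zero]
    refine this.trans_eq ?_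
    ring

end IndependentMaximal

/-! ### Regular complements -/

section RegularComplement

variable {V : Type*} [Fintype V] [DecidableEq V] (G : SimpleGraph V) [DecidableRel G.Adj]

theorem trace_lapMatrix : (G.lapMatrix ℝ).trace = ∑ v, (G.degree v : ℝ) := by
  simp [SimpleGraph.lapMatrix, SimpleGraph.degMatrix]

theorem trace_lapMatrix_mul_self :
    (G.lapMatrix ℝ * G.lapMatrix ℝ).trace = ∑ v, ((G.degree v : ℝ) ^ 2 + G.degree v) := by
  simp only [Matrix.trace, Matrix.diag_apply, Matrix.mul_apply]
  refine Finset.sum_congr rfl fun i _ => ?_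
  have h : ∀ j, G.lapMatrix ℝ i j * G.lapMatrix ℝ j i =
      (if i = j then (G.degree i : ℝ) ^ 2 else 0) + if G.Adj i j then 1 else 0 := fun j => by
    by_cases hij : i = j
    · subst hij; simp [SimpleGraph.lapMatrix, SimpleGraph.degMatrix, sq]
    · by_cases ha : G.Adj i j
      · simp [SimpleGraph.lapMatrix, SimpleGraph.degMatrix, hij, Ne.symm hij, ha, ha.symm]
      · simp [SimpleGraph.lapMatrix, SimpleGraph.degMatrix, hij, ha]
  simp only [h, Finset.sum_add_distrib, Finset.sum_ite_eq, Finset.mem_univ, if_true,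
    SimpleGraph.degree_eq_sum_if_adj]

theorem sub_two_mul_le_of_compl_regular {k : ℕ} (hk : ∀ v, Gᶜ.degree v = k) (x : V → ℝ)
    (hx : ∑ i, x i = 0) : (Fintype.card V - 2 * k : ℝ) * ∑ i, x i ^ 2 ≤ lapForm G x := by
  have h1 := lapForm_add_lapForm_compl G x
  have h2 := lapForm_le_degree_sum Gᶜ x
  simp only [hk, ← Finset.mul_sum] at h2
  rw [hx] at h1
  linarith

/-- The spectral facts used for a graph with regular complement: all but the last two eigenvalues
are at least the third smallest one, and the last two are bounded below. -/
theorem compl_regular_spectral {n : ℕ} (hn : Fintype.card V = n) (hn3 : 2 < n) {k : ℕ}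
    (hk : ∀ v, Gᶜ.degree v = k) :
    ∃ (l : Fin (Fintype.card V) → ℝ) (p q : Fin (Fintype.card V)), p ≠ q ∧
      (∀ i, i ≠ p → i ≠ q → laplacianEigenvalue G ⟨n - 3, sub_three_lt_card hn hn3⟩ ≤ l i) ∧
      (n - 2 * k : ℝ) ≤ l p ∧ 0 ≤ l q ∧
      ∑ i, l i = n * (n - 1 - k) ∧ ∑ i, l i ^ 2 = n * ((n - 1 - k) ^ 2 + (n - 1 - k)) ∧
      ∃ y : V → ℝ, y ≠ 0 ∧ ∑ i, y i = 0 ∧ lapForm G y ≤ l p * ∑ i, y i ^ 2 := by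
  have hA := G.isHermitian_lapMatrix ℝ
  have hdot : ∀ x : V → ℝ, x ⬝ᵥ x = ∑ i, x i ^ 2 := fun x => by simp [dotProduct, sq]
  have hpos : ∀ x : V → ℝ, x ≠ 0 → 0 < ∑ i, x i ^ 2 := fun x hx0 => by
    obtain ⟨i, hi⟩ := Function.ne_iff.1 hx0
    exact Finset.sum_pos' (fun _ _ => sq_nonneg _) ⟨i, Finset.mem_univ _, by
      have : x i ≠ 0 := hi
      positivity⟩
  have hdeg : ∀ v, (G.degree v : ℝ) = n - 1 - k := fun v => by
    have h1 := G.degree_compl v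
    have h2 := G.degree_lt_card_verts v
    rw [hk, hn] at h1
    have h3 : G.degree v + 1 + k = n := by omega
    rw [← h3]; push_cast; ring
  -- The zero-based positions `n - 2` and `n - 1` hold `μ_{n-1}` and `μ_n`.
  refine ⟨hA.eigenvalues₀, ⟨n - 2, by omega⟩, ⟨n - 1, by omega⟩, ?_, ?_, ?_, ?_, ?_, ?_, ?_⟩
  · simp only [ne_eq, Fin.mk.injEq]; omega
  · intro i hp hq
    refine hA.eigenvalues₀_antitone ?_
    rw [Fin.le_def]
    simp only [ne_eq, Fin.ext_iff] at hp hq ⊢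
    have := i.2
    omega
  · obtain ⟨y, hy0, hy1, hy⟩ := hA.exists_form_le_eigenvalues₀ ⟨n - 2, by omega⟩ 1
      (by simp; omega) ![fun _ => 1]
    have hs : ∑ i, y i = 0 := by simpa [dotProduct] using hy1 0
    have h1 := sub_two_mul_le_of_compl_regular G hk y hs
    rw [hdot] at hy
    rw [hn] at h1
    exact le_of_mul_le_mul_right (h1.trans hy) (hpos y hy0)
  · obtain ⟨y, hy0, -, hy⟩ := hA.exists_form_le_eigenvalues₀ ⟨n - 1, by omega⟩ 0
      (by simp; omega) ![]
    have h1 : 0 ≤ lapForm G y := by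
      rw [lapForm_eq_sum]
      refine div_nonneg (Finset.sum_nonneg fun i _ => Finset.sum_nonneg fun j _ => ?_) zero_le_two
      split_ifs <;> positivity
    rw [hdot] at hy
    exact nonneg_of_mul_nonneg_left (h1.trans hy) (hpos y hy0)
  · rw [hA.sum_eigenvalues₀, trace_lapMatrix]
    simp [hdeg, hn]; ring
  · rw [hA.sum_eigenvalues₀_sq, trace_lapMatrix_mul_self]
    simp [hdeg, hn]; ring
  · obtain ⟨y, hy0, hy1, hy⟩ := hA.exists_form_le_eigenvalues₀ ⟨n - 2, by omega⟩ 1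
      (by simp; omega) ![fun _ => 1]
    rw [hdot] at hy
    exact ⟨y, hy0, by simpa [dotProduct] using hy1 0, hy⟩

/-- The trace gives `(n-2)μ + (n-2k) + 0 ≤ n(n-1-k)`, which is `(n-2)μ ≤ (n-2)(n-k)`. Equality fixes
the whole spectrum, and the second moment then leaves only `n = 2k`. In that case `μ_{n-1} = 0`, so
its eigenvector is constant along edges. -/
theorem laplacianEigenvalue_le_of_compl_regular {n : ℕ} (hn : Fintype.card V = n) (hn3 : 2 < n)
    {k : ℕ} (hk : ∀ v, Gᶜ.degree v = k) :
    laplacianEigenvalue G ⟨n - 3, sub_three_lt_card hn hn3⟩ ≤ n - k ∧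
    (1 ≤ k → laplacianEigenvalue G ⟨n - 3, sub_three_lt_card hn hn3⟩ = n - k →
      n = 2 * k ∧ ∃ y : V → ℝ, y ≠ 0 ∧ ∑ i, y i = 0 ∧ ∀ i j, G.Adj i j → y i = y j) := by
  obtain ⟨l, p, q, hpq, hle, hp, hq, hsum, hsq, y, hy0, hy1, hy⟩ := compl_regular_spectral G hn hn3 hk
  set μ := laplacianEigenvalue G ⟨n - 3, sub_three_lt_card hn hn3⟩ with hμ
  set T := (Finset.univ.erase p).erase q with hT
  have hsplit : ∀ f : Fin (Fintype.card V) → ℝ, ∑ i, f i = f p + (f q + ∑ i ∈ T, f i) := fun f => by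
    rw [← Finset.add_sum_erase _ _ (Finset.mem_univ p),
      ← Finset.add_sum_erase _ _ (Finset.mem_erase.2 ⟨hpq.symm, Finset.mem_univ q⟩)]
  have hTc : (T.card : ℝ) = n - 2 := by
    have : T.card + 2 = n := by
      rw [hT, Finset.card_erase_of_mem (Finset.mem_erase.2 ⟨hpq.symm, Finset.mem_univ q⟩),
        Finset.card_erase_of_mem (Finset.mem_univ p), Finset.card_univ, Fintype.card_fin, hn]
      omega
    rw [← this]; push_cast; ring
  have hTle : ∀ i ∈ T, μ ≤ l i := fun i hi => by
    simp only [hT, Finset.mem_erase, Finset.mem_univ, and_true] at hi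
    exact hle i hi.2 hi.1
  have hTsum : (n - 2) * μ ≤ ∑ i ∈ T, l i := by
    have := Finset.card_nsmul_le_sum T l μ hTle
    rwa [nsmul_eq_mul, hTc] at this
  have hn3R : (3 : ℝ) ≤ n := by exact_mod_cast hn3
  rw [hsplit] at hsum
  refine ⟨?_, fun hk1 heq => ?_⟩
  · have : (n - 2 : ℝ) * μ ≤ (n - 2) * (n - k) := by nlinarith
    exact le_of_mul_le_mul_left this (by linarith)
  · rw [heq] at hTsum
    have hlp : l p = n - 2 * k := by nlinarith
    have hlq : l q = 0 := by nlinarith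
    have hTeq : ∑ i ∈ T, (l i - μ) = 0 := by
      rw [Finset.sum_sub_distrib, Finset.sum_const, nsmul_eq_mul, hTc, heq]
      nlinarith
    have hTall : ∀ i ∈ T, l i = n - k := fun i hi => by
      have := (Finset.sum_eq_zero_iff_of_nonneg fun i hi => sub_nonneg.2 (hTle i hi)).1 hTeq i hi
      linarith
    rw [hsplit, hlp, hlq, Finset.sum_congr rfl fun i hi => by rw [hTall i hi], Finset.sum_const,
      nsmul_eq_mul, hTc] at hsq
    -- The prescribed sum of squares minus the one of this spectrum equals `k(n-2k)`.
    have hprod : (k : ℝ) * (n - 2 * k) = 0 := by nlinarith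
    have hk0 : (k : ℝ) ≠ 0 := by exact_mod_cast (by omega : k ≠ 0)
    have hnk : (n : ℝ) - 2 * k = 0 := (mul_eq_zero.1 hprod).resolve_left hk0
    refine ⟨by have : (n : ℝ) = 2 * k := by linarith
               exact_mod_cast this, y, hy0, hy1, ?_⟩
    rw [hlp, hnk, zero_mul] at hy
    have h0 : 0 ≤ lapForm G y := by
      rw [lapForm_eq_sum]
      refine div_nonneg (Finset.sum_nonneg fun i _ => Finset.sum_nonneg fun j _ => ?_) zero_le_two
      split_ifs <;> positivity
    rw [← SimpleGraph.lapMatrix_toLinearMap₂'_apply'_eq_zero_iff_forall_adj,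
      Matrix.toLinearMap₂'_apply']
    exact le_antisymm hy h0

/-- A graph on `2 k` vertices in which all degrees are `k - 1`, and on which a nonconstant function
is constant along edges, is the disjoint union of two cliques of size `k`. -/
theorem exists_two_clique_partition {n k : ℕ} (hn : Fintype.card V = n) (hnk : n = 2 * k)
    (hk : ∀ v, Gᶜ.degree v = k) {y : V → ℝ} (hy0 : y ≠ 0) (hy1 : ∑ i, y i = 0)
    (hy : ∀ i j, G.Adj i j → y i = y j) :
    ∃ A : Finset V, A.card = k ∧ ∀ x z, G.Adj x z ↔ x ≠ z ∧ (x ∈ A ↔ z ∈ A) := by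
  obtain ⟨u, v, huv⟩ : ∃ u v, y u ≠ y v := by
    by_contra hall
    push Not at hall
    obtain ⟨i, hi⟩ := Function.ne_iff.1 hy0
    have h1 : ∑ j, y j = Fintype.card V * y i := by
      rw [Finset.sum_congr rfl fun j _ => hall j i]; simp
    rw [hy1] at h1
    have hpos : 0 < Fintype.card V := Fintype.card_pos_iff.2 ⟨i⟩
    have h2 : (Fintype.card V : ℝ) ≠ 0 := by exact_mod_cast hpos.ne'
    exact (mul_ne_zero h2 hi) h1.symm
  -- Closed neighbourhoods have `k` elements. Those of `u` and `v` are disjoint because `y`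
  -- separates them, so they fill all `2k` vertices, and every closed neighbourhood coincides with
  -- one of the two.
  set N : V → Finset V := fun z => insert z (G.neighborFinset z) with hN
  have hNc : ∀ z, (N z).card = k := fun z => by
    have h1 := G.degree_compl z
    have h2 := G.degree_lt_card_verts z
    rw [hk, hn] at h1
    rw [hN, Finset.card_insert_of_notMem (by simp), SimpleGraph.card_neighborFinset_eq_degree]
    omega
  have hNy : ∀ z, ∀ x ∈ N z, y x = y z := fun z x hx => by
    rcases Finset.mem_insert.1 hx with rfl | h
    · rfl
    · exact (hy z x (by simpa using h)).symm
  have hdisj : Disjoint (N u) (N v) := Finset.disjoint_left.2 fun x hx hx' =>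
    huv ((hNy u x hx).symm.trans (hNy v x hx'))
  have hcover : N u ∪ N v = Finset.univ := by
    rw [← Finset.card_eq_iff_eq_univ, Finset.card_union_of_disjoint hdisj, hNc, hNc, hn]
    omega
  have hmem : ∀ x, x ∈ N u ∨ x ∈ N v := fun x => by
    rw [← Finset.mem_union, hcover]; exact Finset.mem_univ x
  have hNu : ∀ z ∈ N u, N z = N u := fun z hz => by
    refine Finset.eq_of_subset_of_card_le (fun x hx => ?_) (by rw [hNc, hNc])
    refine (hmem x).resolve_right fun h => huv ?_
    rw [← hNy u z hz, ← hNy z x hx, hNy v x h]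
  have hNv : ∀ z ∈ N v, N z = N v := fun z hz => by
    refine Finset.eq_of_subset_of_card_le (fun x hx => ?_) (by rw [hNc, hNc])
    refine (hmem x).resolve_left fun h => huv ?_
    rw [← hNy v z hz, ← hNy z x hx, hNy u x h]
  have hadj : ∀ x z, G.Adj x z ↔ x ≠ z ∧ z ∈ N x := fun x z => by
    simp only [hN, Finset.mem_insert, SimpleGraph.mem_neighborFinset]
    constructor
    · exact fun h => ⟨h.ne, Or.inr h⟩
    · rintro ⟨h1, h2⟩
      exact h2.resolve_left (Ne.symm h1)
  refine ⟨N u, hNc u, fun x z => ?_⟩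
  rw [hadj]
  refine and_congr_right fun _ => ?_
  rcases hmem x with hx | hx
  · rw [hNu x hx]; simp [hx]
  · have hx' : x ∉ N u := fun h => Finset.disjoint_left.1 hdisj h hx
    rw [hNv x hx]
    simp only [hx', false_iff]
    exact ⟨fun h h' => Finset.disjoint_left.1 hdisj h' h, fun h => (hmem z).resolve_left h⟩

end RegularComplement

/-! ### Recognising the extremal and excluded graphs by vertex colourings -/

section ColouredIso

variable {V W : Type*}

/-- Two graphs whose adjacency is determined by vertex colours in the same way are isomorphic when
the colour classes have the same sizes. -/
theorem nonempty_iso_of_colouring [Fintype V] [Fintype W] {ι : Type*} [DecidableEq ι]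
    {G : SimpleGraph V} {H : SimpleGraph W} (f : V → ι) (g : W → ι) (R : ι → ι → Prop)
    (hG : ∀ x y, G.Adj x y ↔ x ≠ y ∧ R (f x) (f y))
    (hH : ∀ x y, H.Adj x y ↔ x ≠ y ∧ R (g x) (g y))
    (hcard : ∀ i, Fintype.card {x // f x = i} = Fintype.card {x // g x = i}) :
    Nonempty (G ≃g H) := by
  let e : V ≃ W := Equiv.ofFiberEquiv (f := f) (g := g) fun i => Fintype.equivOfCardEq (hcard i)
  have he : ∀ x, g (e x) = f x := fun x => Equiv.ofFiberEquiv_map _ x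
  refine ⟨⟨e, fun {x y} => ?_⟩⟩
  rw [hG, hH, he, he, e.injective.ne_iff]

theorem exists_colouring_of_iso [Fintype V] [Fintype W] {ι : Type*} [DecidableEq ι]
    {G : SimpleGraph V} {H : SimpleGraph W} (g : W → ι) (R : ι → ι → Prop)
    (hH : ∀ x y, H.Adj x y ↔ x ≠ y ∧ R (g x) (g y)) (e : G ≃g H) :
    ∃ f : V → ι, (∀ x y, G.Adj x y ↔ x ≠ y ∧ R (f x) (f y)) ∧
      ∀ i, Fintype.card {x // f x = i} = Fintype.card {x // g x = i} :=
  ⟨fun x => g (e x), fun x y => by rw [← e.map_adj_iff, hH, e.injective.ne_iff], fun i =>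
    Fintype.card_congr (e.toEquiv.subtypeEquiv fun _ => Iff.rfl)⟩

/-- The side of a vertex of a disjoint union. -/
def sumColour (a b : ℕ) : Fin a ⊕ Fin b → Bool := Sum.isLeft

theorem sum_completeK_adj (a b : ℕ) (x y : Fin a ⊕ Fin b) :
    (SimpleGraph.sum (completeK a) (completeK b)).Adj x y ↔
      x ≠ y ∧ sumColour a b x = sumColour a b y := by
  rcases x with x | x <;> rcases y with y | y <;> simp [sumColour]

theorem card_sumColour (a b : ℕ) (i : Bool) :
    Fintype.card {x // sumColour a b x = i} = if i then a else b := by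
  rw [Fintype.card_subtype, Finset.card_filter, Fintype.sum_sum_type]
  cases i <;> simp [sumColour]

/-- The part of `(K_1 ∪ K_a) ∨ K_b` that a vertex belongs to. -/
def pointUnionCliqueJoinColour (a b : ℕ) : (Fin 1 ⊕ Fin a) ⊕ Fin b → Fin 3 :=
  Sum.elim (Sum.elim (fun _ => 0) fun _ => 1) fun _ => 2

/-- Only the single vertex and the clique `K_a` are not joined. -/
def pointUnionCliqueJoinRel (i j : Fin 3) : Prop := ¬ ((i = 0 ∧ j = 1) ∨ (j = 0 ∧ i = 1))

theorem pointUnionCliqueJoin_adj (a b : ℕ) (x y : (Fin 1 ⊕ Fin a) ⊕ Fin b) :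
    (pointUnionCliqueJoin a b).Adj x y ↔ x ≠ y ∧
      pointUnionCliqueJoinRel
        (pointUnionCliqueJoinColour a b x) (pointUnionCliqueJoinColour a b y) := by
  rcases x with (x | x) | x <;> rcases y with (y | y) | y <;>
    simp [pointUnionCliqueJoinRel, pointUnionCliqueJoinColour, graphJoin]

theorem card_pointUnionCliqueJoinColour (a b : ℕ) (i : Fin 3) :
    Fintype.card {x // pointUnionCliqueJoinColour a b x = i} = ![1, a, b] i := by
  rw [Fintype.card_subtype, Finset.card_filter, Fintype.sum_sum_type, Fintype.sum_sum_type]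
  fin_cases i <;> simp [pointUnionCliqueJoinColour]

theorem nonempty_iso_completeK_iff [Fintype V] (G : SimpleGraph V) {n : ℕ} (hn : Fintype.card V = n) :
    Nonempty (G ≃g completeK n) ↔ G = ⊤ := by
  constructor
  · rintro ⟨e⟩
    ext x y
    rw [← e.map_adj_iff]
    simp
  · rintro rfl
    exact ⟨SimpleGraph.Iso.completeGraph (Fintype.equivFinOfCardEq hn)⟩

variable [Fintype V] [DecidableEq V] (G : SimpleGraph V)

theorem nonempty_iso_sum_completeK_iff {n m : ℕ} (hn : Fintype.card V = n) (hnm : n = 2 * m) :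
    Nonempty (G ≃g SimpleGraph.sum (completeK m) (completeK m)) ↔
      ∃ A : Finset V, A.card = m ∧ ∀ x z, G.Adj x z ↔ x ≠ z ∧ (x ∈ A ↔ z ∈ A) := by
  constructor
  · rintro ⟨e⟩
    obtain ⟨f, hf, hc⟩ := exists_colouring_of_iso _ (· = ·) (sum_completeK_adj m m) e
    refine ⟨Finset.univ.filter fun x => f x = true, ?_, fun x z => ?_⟩
    · rw [← Fintype.card_subtype, hc, card_sumColour, if_pos rfl]
    · rw [hf]
      simp only [Finset.mem_filter, Finset.mem_univ, true_and]
      rw [← Bool.eq_iff_iff]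
  · rintro ⟨A, hA, hadj⟩
    refine nonempty_iso_of_colouring (fun x => decide (x ∈ A)) _ (· = ·) (fun x y => ?_)
      (sum_completeK_adj m m) fun i => ?_
    · rw [hadj]; simp
    · rw [card_sumColour, Fintype.card_subtype]
      cases i
      · have h : (Finset.univ.filter fun x => decide (x ∈ A) = false) = Aᶜ := by ext; simp
        rw [h, Finset.card_compl, hA, hn]; simp; omega
      · have h : (Finset.univ.filter fun x => decide (x ∈ A) = true) = A := by ext; simp
        rw [h, hA]; simp

/-- The complement of `G` is a star with centre `c` and set of leaves `S`, plus isolated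
vertices. -/
def IsComplStar {V : Type*} (G : SimpleGraph V) (c : V) (S : Finset V) : Prop :=
  c ∉ S ∧ ∀ x y, Gᶜ.Adj x y ↔ (x = c ∧ y ∈ S) ∨ (y = c ∧ x ∈ S)

/-- The only missing edges of `(K_1 ∪ K_a) ∨ K_b` run from the single vertex to `K_a`; they form a
star with `a` leaves. -/
theorem nonempty_iso_pointUnionCliqueJoin_iff {n a b : ℕ} (hn : Fintype.card V = n)
    (hnab : n = 1 + a + b) :
    Nonempty (G ≃g pointUnionCliqueJoin a b) ↔
      ∃ c S, IsComplStar G c S ∧ S.card = a := by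
  constructor
  · rintro ⟨e⟩
    obtain ⟨f, hf, hc⟩ := exists_colouring_of_iso _ _ (pointUnionCliqueJoin_adj a b) e
    simp only [card_pointUnionCliqueJoinColour] at hc
    obtain ⟨⟨c, hc0⟩, hcu⟩ := Fintype.card_eq_one_iff.1 (hc 0)
    have hc1 : ∀ x, f x = 0 ↔ x = c := fun x =>
      ⟨fun h => congrArg Subtype.val (hcu ⟨x, h⟩), fun h => h ▸ hc0⟩
    refine ⟨c, Finset.univ.filter fun x => f x = 1, ⟨by simp [hc0], fun x y => ?_⟩, ?_⟩
    · rw [SimpleGraph.compl_adj, hf]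
      simp only [pointUnionCliqueJoinRel, hc1, Finset.mem_filter, Finset.mem_univ, true_and]
      constructor
      · rintro ⟨h1, h2⟩
        by_contra h3
        exact h2 ⟨h1, h3⟩
      · intro h
        refine ⟨?_, fun h2 => h2.2 h⟩
        rintro rfl
        rcases h with ⟨rfl, h⟩ | ⟨rfl, h⟩ <;> simp [hc0] at h
    · rw [← Fintype.card_subtype, hc]; rfl
  · rintro ⟨c, S, ⟨hcS, hadj⟩, hS⟩
    set f : V → Fin 3 := fun x => if x = c then 0 else if x ∈ S then 1 else 2 with hf
    have h0 : ∀ x, f x = 0 ↔ x = c := fun x => by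
      simp only [hf]; split_ifs <;> simp_all
    have h1 : ∀ x, f x = 1 ↔ x ∈ S := fun x => by
      simp only [hf]
      split_ifs with h h'
      · subst h; simp [hcS]
      · simp [h']
      · simp [h']
    have c0 : Fintype.card {x // f x = 0} = 1 := by
      simp only [h0]; simp
    have c1 : Fintype.card {x // f x = 1} = a := by
      simp only [h1]; simp [hS]
    have c2 : Fintype.card {x // f x = 2} = b := by
      have h := Fintype.card_congr (Equiv.sigmaFiberEquiv f)
      rw [Fintype.card_sigma, Fin.sum_univ_three, c0, c1, hn] at h
      omega
    refine nonempty_iso_of_colouring f _ _ (fun x y => ?_) (pointUnionCliqueJoin_adj a b)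
      fun i => ?_
    · have h := hadj x y
      rw [SimpleGraph.compl_adj] at h
      simp only [pointUnionCliqueJoinRel, h0, h1, ← h]
      constructor
      · exact fun h => ⟨h.ne, fun h' => h'.2 h⟩
      · rintro ⟨h2, h3⟩
        by_contra h4
        exact h3 ⟨h2, h4⟩
    · rw [card_pointUnionCliqueJoinColour]
      fin_cases i
      · exact c0
      · exact c1
      · exact c2

end ColouredIso

/-! ### Lower bounds for the extremal graphs -/

section Equality

variable {V : Type*} [Fintype V] [DecidableEq V] (G : SimpleGraph V) [DecidableRel G.Adj]

theorem sum_compl_degree_of_isComplStar {c : V} {S : Finset V} (h : IsComplStar G c S) :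
    ∑ v, (Gᶜ.degree v : ℝ) = 2 * S.card := by
  have h1 : ∀ x y, (if Gᶜ.Adj x y then (1 : ℝ) else 0) =
      (if x = c then if y ∈ S then 1 else 0 else 0) +
        (if y = c then if x ∈ S then 1 else 0 else 0) := fun x y => by
    rw [if_congr (h.2 x y) rfl rfl]
    have := h.1
    by_cases hx : x = c <;> by_cases hy : y = c <;> simp_all
  simp only [SimpleGraph.degree_eq_sum_if_adj, h1, Finset.sum_add_distrib, Finset.sum_ite_eq',
    Finset.mem_univ, if_true]
  rw [Finset.sum_comm]
  simp
  ring

theorem le_laplacianEigenvalue_top {n : ℕ} (hn : Fintype.card V = n) (hn3 : 2 < n) (hG : G = ⊤) :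
    (n : ℝ) ≤ laplacianEigenvalue G ⟨n - 3, sub_three_lt_card hn hn3⟩ := by
  refine le_laplacianEigenvalue_of_form G hn hn3 (fun _ => 1) 0 n fun x hx _ => ?_
  have h1 := lapForm_add_lapForm_compl G x
  have h2 : ∑ i, x i = 0 := by simpa [dotProduct] using hx
  have h3 : lapForm Gᶜ x = 0 := by
    rw [lapForm_eq_sum]
    simp [hG]
  rw [h2, h3, hn] at h1
  linarith

/-- A vector summing to zero on `A` and on its complement satisfies `Lx = mx`, since the neighbours
of a vertex `i` then sum to `-x i`. These are two linear constraints. -/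
theorem le_laplacianEigenvalue_two_clique {n m : ℕ} (hn : Fintype.card V = n) (hn3 : 2 < n)
    {A : Finset V} (hA : A.card = m) (hnm : n = 2 * m)
    (hadj : ∀ x z, G.Adj x z ↔ x ≠ z ∧ (x ∈ A ↔ z ∈ A)) :
    (m : ℝ) ≤ laplacianEigenvalue G ⟨n - 3, sub_three_lt_card hn hn3⟩ ∧ ∀ v, Gᶜ.degree v = m := by
  have hN : ∀ x, G.neighborFinset x = (if x ∈ A then A else Aᶜ).erase x := fun x => by
    ext z
    rw [SimpleGraph.mem_neighborFinset, hadj, Finset.mem_erase]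
    by_cases hx : x ∈ A <;> simp [hx, ne_comm]
  have hAc : Aᶜ.card = m := by rw [Finset.card_compl, hA, hn]; omega
  have hmem : ∀ x, x ∈ (if x ∈ A then A else Aᶜ) := fun x => by
    by_cases hx : x ∈ A <;> simp [hx]
  have hcard : ∀ x, (if x ∈ A then A else Aᶜ).card = m := fun x => by
    by_cases hx : x ∈ A <;> simp only [hx, if_true, if_false, hA, hAc]
  have hdeg : ∀ x, G.degree x = m - 1 := fun x => by
    rw [← SimpleGraph.card_neighborFinset_eq_degree, hN, Finset.card_erase_of_mem (hmem x), hcard]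
  refine ⟨?_, fun v => by rw [SimpleGraph.degree_compl, hdeg, hn]; omega⟩
  refine le_laplacianEigenvalue_of_form G hn hn3 (fun x => if x ∈ A then 1 else 0)
    (fun x => if x ∈ A then 0 else 1) m fun x hx1 hx2 => le_of_eq ?_
  have h1 : ∑ i ∈ A, x i = 0 := by simpa [dotProduct] using hx1
  have h2 : ∑ i ∈ Aᶜ, x i = 0 := by
    have : ∀ i, (if i ∈ A then (0 : ℝ) else 1) * x i = if i ∈ Aᶜ then x i else 0 := fun i => by
      by_cases hi : i ∈ A <;> simp [hi]
    simp only [dotProduct, this] at hx2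
    rwa [Finset.sum_ite_mem, Finset.univ_inter] at hx2
  have h3 : ∀ i, ∑ j ∈ G.neighborFinset i, x j = - x i := fun i => by
    have h4 := Finset.add_sum_erase _ x (hmem i)
    have h5 : ∑ j ∈ (if i ∈ A then A else Aᶜ), x j = 0 := by
      by_cases hi : i ∈ A <;> simp only [hi, if_true, if_false, h1, h2]
    rw [hN]
    linarith
  have hm : ((m - 1 : ℕ) : ℝ) = m - 1 := by rw [Nat.cast_sub (by omega)]; simp
  rw [lapForm, dotProduct, Finset.mul_sum]
  refine Finset.sum_congr rfl fun i _ => ?_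
  rw [SimpleGraph.lapMatrix_mulVec_apply, h3, hdeg, hm]
  ring

/-- For `x` orthogonal to constants and vanishing at the centre, each edge of the complement star
contributes the square at its leaf, so the complement form is at most `‖x‖²`. -/
theorem le_laplacianEigenvalue_complStar {n : ℕ} (hn : Fintype.card V = n) (hn3 : 2 < n)
    {c : V} {S : Finset V} (h : IsComplStar G c S) :
    (n - 1 : ℝ) ≤ laplacianEigenvalue G ⟨n - 3, sub_three_lt_card hn hn3⟩ := by
  refine le_laplacianEigenvalue_of_form G hn hn3 (fun _ => 1) (Pi.single c 1) (n - 1)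
    fun x hx1 hx2 => ?_
  have h1 := lapForm_add_lapForm_compl G x
  have h2 : ∑ i, x i = 0 := by simpa [dotProduct] using hx1
  have hc : x c = 0 := by simpa using hx2
  have h3 : lapForm Gᶜ x ≤ ∑ i, x i ^ 2 := by
    rw [lapForm_eq_sum, div_le_iff₀ two_pos]
    have h4 : ∀ i j, (if Gᶜ.Adj i j then (x i - x j) ^ 2 else 0) ≤
        (if i = c then x j ^ 2 else 0) + (if j = c then x i ^ 2 else 0) := fun i j => by
      split_ifs with ha hi hj hj hi hj hj
      · subst hi; subst hj; exact absurd rfl ha.ne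
      · subst hi; rw [hc]; nlinarith
      · subst hj; rw [hc]; nlinarith
      · rcases (h.2 i j).1 ha with ⟨h5, -⟩ | ⟨h5, -⟩
        · exact absurd h5 hi
        · exact absurd h5 hj
      all_goals positivity
    refine (Finset.sum_le_sum fun i _ => Finset.sum_le_sum fun j _ => h4 i j).trans (le_of_eq ?_)
    simp only [Finset.sum_add_distrib, Finset.sum_ite_eq', Finset.mem_univ, if_true]
    rw [Finset.sum_comm]
    simp
    ring
  rw [h2, hn] at h1
  linarith

end Equality

/-! ### Strict bound for other complements, and the bound for stars -/

section Bound

variable {V : Type*} [Fintype V] [DecidableEq V] (G : SimpleGraph V) [DecidableRel G.Adj]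

/-- A complement that is neither regular nor a star with isolated vertices gives a strict bound. -/
theorem laplacianEigenvalue_lt_of_not_star {n : ℕ} (hn : Fintype.card V = n) (hn3 : 2 < n)
    (hreg : ¬ ∃ k, ∀ v, Gᶜ.degree v = k)
    (hstar : ∀ u, ∃ x y, x ≠ u ∧ y ≠ u ∧ Gᶜ.Adj x y)
    {d : ℝ} (hd : n * d = ∑ v, (Gᶜ.degree v : ℝ)) :
    laplacianEigenvalue G ⟨n - 3, sub_three_lt_card hn hn3⟩ < n - d := by
  have : Nonempty V := Fintype.card_pos_iff.1 (by omega)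
  obtain ⟨u, -, hu⟩ := Finset.exists_max_image Finset.univ (fun v => Gᶜ.degree v)
    Finset.univ_nonempty
  obtain ⟨x, y, hxu, hyu, hxy⟩ := hstar u
  obtain ⟨v, hv, hvmax⟩ := Finset.exists_max_image (Finset.univ.erase u) (fun v => Gᶜ.degree v)
    ⟨x, by simp [hxu]⟩
  have hvu : v ≠ u := Finset.ne_of_mem_erase hv
  have hmax : ∀ w, w ≠ u → Gᶜ.degree w ≤ Gᶜ.degree v := fun w hw => hvmax w (by simp [hw])
  have hkD : Gᶜ.degree v ≤ Gᶜ.degree u := hu v (Finset.mem_univ v)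
  have hpos : ∀ a b, Gᶜ.Adj a b → 1 ≤ Gᶜ.degree a := fun a b h =>
    (Gᶜ.degree_pos_iff_exists_adj a).2 ⟨b, h⟩
  have hx1 := hpos x y hxy
  have hk1 : 1 ≤ Gᶜ.degree v := hx1.trans (hmax x hxu)
  have hsum : ∑ w, (Gᶜ.degree w : ℝ) ≤ Gᶜ.degree u + (n - 1) * Gᶜ.degree v := by
    rw [← Finset.add_sum_erase _ _ (Finset.mem_univ u)]
    refine add_le_add le_rfl ?_
    refine (Finset.sum_le_card_nsmul _ _ (Gᶜ.degree v : ℝ) fun w hw => ?_).trans (le_of_eq ?_)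
    · exact_mod_cast hmax w (Finset.ne_of_mem_erase hw)
    · rw [nsmul_eq_mul, Finset.card_erase_of_mem (Finset.mem_univ u), Finset.card_univ, hn,
        Nat.cast_sub (by omega)]
      simp
  set k := Gᶜ.degree v with hk
  rcases lt_or_ge d k with hdk | hkd
  · refine lt_of_le_of_lt ?_ (by linarith : (n - k : ℝ) < n - d)
    rcases Nat.lt_or_ge k 2 with hk2 | hk2
    · have hkone : k = 1 := by omega
      have hux : ¬ Gᶜ.Adj u x := fun hadj => by
        have h2 : 2 ≤ Gᶜ.degree x := by
          rw [← SimpleGraph.card_neighborFinset_eq_degree, ← Finset.card_pair hyu]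
          refine Finset.card_le_card fun z hz => ?_
          simp only [Finset.mem_insert, Finset.mem_singleton] at hz
          rw [SimpleGraph.mem_neighborFinset]
          rcases hz with rfl | rfl
          · exact hxy
          · exact hadj.symm
        have := hmax x hxu
        omega
      exact laplacianEigenvalue_le_of_compl_nonadj G hn hn3 hxu.symm hux hk1 hkD (by omega)
    · by_cases hadj : Gᶜ.Adj u v
      · exact laplacianEigenvalue_le_of_compl_adj G hn hn3 hadj hk2 hkD le_rfl
      · exact laplacianEigenvalue_le_of_compl_nonadj G hn hn3 hvu.symm hadj hk1 hkD le_rfl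
  · have hlt : k < Gᶜ.degree u := by
      -- If `D = k`, all degrees are at most `k ≤ d`; as `d` is their average, they all equal `k`.
      refine lt_of_le_of_ne hkD fun heq => hreg ⟨k, ?_⟩
      have hle : ∀ w ∈ Finset.univ, (Gᶜ.degree w : ℝ) ≤ k := fun w hw => by
        rw [heq]; exact_mod_cast hu w hw
      have hn0 : (0 : ℝ) ≤ n := Nat.cast_nonneg n
      have h1 : ∑ w : V, (k : ℝ) = n * k := by simp [hn]
      have h2 : ∑ w, (Gᶜ.degree w : ℝ) = ∑ w : V, (k : ℝ) := by
        refine le_antisymm (Finset.sum_le_sum hle) ?_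
        rw [h1, ← hd]
        exact mul_le_mul_of_nonneg_left hkd hn0
      intro w
      exact_mod_cast (Finset.sum_eq_sum_iff_of_le hle).1 h2 w (Finset.mem_univ w)
    by_cases hedge : ∃ a b, a ≠ u ∧ b ≠ u ∧ Gᶜ.degree a = k ∧ Gᶜ.degree b = k ∧ Gᶜ.Adj a b
    · obtain ⟨a, b, hau, hbu, ha, hb, hab⟩ := hedge
      exact laplacianEigenvalue_lt_of_compl_edge G hn hn3 hau.symm hbu.symm hab ha hb hlt hkd
        (by linarith)
    -- For `k = 1` the edge `xy` itself would join two vertices of degree `k`.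
    · have hk2 : 2 ≤ k := by
        by_contra hk2
        have hy1 := hpos y x hxy.symm
        have h1 := hmax x hxu
        have h2 := hmax y hyu
        exact hedge ⟨x, y, hxu, hyu, by omega, by omega, hxy⟩
      exact laplacianEigenvalue_lt_of_compl_independent G hn hn3 hvu.symm hk.symm hmax
        (fun a b h1 h2 h3 h4 h5 => hedge ⟨a, b, h1, h2, h3, h4, h5⟩) hk2 hlt hkd hd

theorem laplacianEigenvalue_le_of_isComplStar {n : ℕ} (hn : Fintype.card V = n) (hn3 : 2 < n)
    {c : V} {S : Finset V} (h : IsComplStar G c S) (hS : 2 ≤ S.card) :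
    laplacianEigenvalue G ⟨n - 3, sub_three_lt_card hn hn3⟩ ≤ n - 1 := by
  obtain ⟨a, ha, b, hb, hab⟩ := Finset.one_lt_card.1 hS
  have hdeg : ∀ x ∈ S, 1 ≤ Gᶜ.degree x := fun x hx =>
    (Gᶜ.degree_pos_iff_exists_adj x).2 ⟨c, (h.2 x c).2 (Or.inr ⟨rfl, hx⟩)⟩
  have hnadj : ¬ Gᶜ.Adj a b := fun hadj => by
    rcases (h.2 a b).1 hadj with ⟨rfl, -⟩ | ⟨rfl, -⟩
    · exact h.1 ha
    · exact h.1 hb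
  have := laplacianEigenvalue_le_of_compl_nonadj G hn hn3 hab hnadj le_rfl (hdeg a ha) (hdeg b hb)
  simpa using this

end Bound

/-! ### The theorem -/

theorem theorem3p6 {V : Type*} [Fintype V] [DecidableEq V]
    (G : SimpleGraph V) [DecidableRel G.Adj]
    (n : ℕ) (hn : Fintype.card V = n) (hn3 : 2 < n)
    (hG : ∀ r : ℕ, ((r : ℤ) ≤ ⌈(n : ℚ) / 2⌉ - 2 ∨ r = n - 2) →
      ¬ Nonempty (G ≃g pointUnionCliqueJoin (n - r - 1) r)) :
    -- `n - 3` is the zero-based position of `μ_{n-2}`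
    laplacianEigenvalue G ⟨n - 3, by omega⟩ ≤ 2 * (G.edgeFinset.card : ℝ) / (n : ℝ) + 1 ∧
    (laplacianEigenvalue G ⟨n - 3, by omega⟩ = 2 * (G.edgeFinset.card : ℝ) / (n : ℝ) + 1 ↔
      Nonempty (G ≃g completeK n) ∨
      (Even n ∧ Nonempty (G ≃g SimpleGraph.sum (completeK (n / 2)) (completeK (n / 2)))) ∨
      (Even n ∧ Nonempty (G ≃g pointUnionCliqueJoin (n / 2) (n / 2 - 1)))) := by
  have hn0 : (0 : ℝ) < n := by exact_mod_cast (by omega : 0 < n)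
  -- `d` is the average degree of the complement.
  obtain ⟨d, hd⟩ : ∃ d : ℝ, n * d = ∑ v, (Gᶜ.degree v : ℝ) :=
    ⟨(∑ v, (Gᶜ.degree v : ℝ)) / n, by field_simp⟩
  have hrhs : 2 * (G.edgeFinset.card : ℝ) / (n : ℝ) + 1 = n - d := by
    have h1 : ∀ v, (Gᶜ.degree v : ℝ) = n - 1 - G.degree v := fun v => by
      have h2 := G.degree_lt_card_verts v
      have h3 : Gᶜ.degree v + 1 + G.degree v = n := by rw [G.degree_compl, hn]; omega
      rw [← h3]; push_cast; ring
    have h2 : ∑ v, (G.degree v : ℝ) = 2 * G.edgeFinset.card := by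
      exact_mod_cast G.sum_degrees_eq_twice_card_edges
    have h3 : n * d = n * (n - 1) - 2 * G.edgeFinset.card := by
      rw [hd, Finset.sum_congr rfl fun v _ => h1 v, Finset.sum_sub_distrib, h2]
      simp [hn]; ring
    field_simp
    linarith
  rw [hrhs]
  have hK := nonempty_iso_completeK_iff G hn
  have h2K : Even n → (Nonempty (G ≃g SimpleGraph.sum (completeK (n / 2)) (completeK (n / 2))) ↔
      ∃ A : Finset V, A.card = n / 2 ∧ ∀ x z, G.Adj x z ↔ x ≠ z ∧ (x ∈ A ↔ z ∈ A)) := fun he =>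
    nonempty_iso_sum_completeK_iff G hn (by obtain ⟨m, rfl⟩ := he; omega)
  have hSt : Even n → (Nonempty (G ≃g pointUnionCliqueJoin (n / 2) (n / 2 - 1)) ↔
      ∃ c S, IsComplStar G c S ∧ S.card = n / 2) := fun he =>
    nonempty_iso_pointUnionCliqueJoin_iff G hn (by obtain ⟨m, rfl⟩ := he; omega)
  have key : laplacianEigenvalue G ⟨n - 3, by omega⟩ ≤ n - d ∧
      (laplacianEigenvalue G ⟨n - 3, by omega⟩ = n - d →
        Nonempty (G ≃g completeK n) ∨
        (Even n ∧ Nonempty (G ≃g SimpleGraph.sum (completeK (n / 2)) (completeK (n / 2)))) ∨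
        (Even n ∧ Nonempty (G ≃g pointUnionCliqueJoin (n / 2) (n / 2 - 1)))) := by
    by_cases hreg : ∃ k, ∀ v, Gᶜ.degree v = k
    · obtain ⟨k, hk⟩ := hreg
      have hdk : d = k := by
        have h1 : n * d = n * k := by rw [hd]; simp [hk, hn]
        exact mul_left_cancel₀ hn0.ne' h1
      obtain ⟨h1, h2⟩ := laplacianEigenvalue_le_of_compl_regular G hn hn3 hk
      rw [hdk]
      refine ⟨h1, fun heq => ?_⟩
      rcases Nat.eq_zero_or_pos k with rfl | hkpos
      · left
        rw [hK]
        ext x y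
        simp only [SimpleGraph.top_adj]
        refine ⟨fun h => h.ne, fun hxy => ?_⟩
        by_contra hnadj
        have := (Gᶜ.degree_pos_iff_exists_adj x).2 ⟨y, (G.compl_adj x y).2 ⟨hxy, hnadj⟩⟩
        rw [hk] at this
        omega
      · obtain ⟨hnk, y, hy0, hy1, hy⟩ := h2 hkpos heq
        have he : Even n := ⟨k, by omega⟩
        right; left
        refine ⟨he, (h2K he).2 ?_⟩
        have : n / 2 = k := by omega
        rw [this]
        exact exists_two_clique_partition G hn hnk hk hy0 hy1 hy
    by_cases hstar : ∀ u, ∃ x y, x ≠ u ∧ y ≠ u ∧ Gᶜ.Adj x y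
    · have := laplacianEigenvalue_lt_of_not_star G hn hn3 hreg hstar hd
      exact ⟨this.le, fun h => absurd h this.ne⟩
    · push Not at hstar
      obtain ⟨c, hc⟩ := hstar
      have hcS : IsComplStar G c (Gᶜ.neighborFinset c) := by
        refine ⟨by simp, fun x y => ?_⟩
        rw [SimpleGraph.mem_neighborFinset, SimpleGraph.mem_neighborFinset]
        constructor
        · intro h
          by_cases hx : x = c
          · subst hx; exact Or.inl ⟨rfl, h⟩
          · by_cases hy : y = c
            · subst hy; exact Or.inr ⟨rfl, h.symm⟩
            · exact absurd h (hc x y hx hy)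
        · rintro (⟨rfl, h⟩ | ⟨rfl, h⟩)
          · exact h
          · exact h.symm
      set S := Gᶜ.neighborFinset c with hS
      have hSn : S.card + 1 ≤ n := by
        have := Gᶜ.degree_lt_card_verts c
        rw [hS, SimpleGraph.card_neighborFinset_eq_degree]
        omega
      have hsum := sum_compl_degree_of_isComplStar G hcS
      have hS0 : S.card ≠ 0 := fun h0 => hreg ⟨0, fun v => by
        rw [h0, Nat.cast_zero, mul_zero] at hsum
        have := (Finset.sum_eq_zero_iff_of_nonneg fun w _ => Nat.cast_nonneg (Gᶜ.degree w)).1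
          hsum v (Finset.mem_univ v)
        exact_mod_cast this⟩
      have hiso : Nonempty (G ≃g pointUnionCliqueJoin (n - (n - 1 - S.card) - 1)
          (n - 1 - S.card)) :=
        (nonempty_iso_pointUnionCliqueJoin_iff G hn (by omega)).2 ⟨c, S, hcS, by omega⟩
      have hnot : ¬ (((n - 1 - S.card : ℕ) : ℤ) ≤ ⌈(n : ℚ) / 2⌉ - 2 ∨ n - 1 - S.card = n - 2) :=
        fun h => hG (n - 1 - S.card) h hiso
      push Not at hnot
      -- The excluded parameter is `r = n - 1 - |S|`, so `r = n - 2` is the case of a single leaf.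
      have hS2 : 2 ≤ S.card := by
        have := hnot.2
        omega
      -- Here `r ≥ ⌈n/2⌉ - 1`, which means `|S| ≤ n - ⌈n/2⌉`.
      have h2S : 2 * S.card ≤ n := by
        have h1 : ((n : ℚ) / 2) ≤ ⌈(n : ℚ) / 2⌉ := Int.le_ceil _
        have h2 : ⌈(n : ℚ) / 2⌉ - 2 + 1 ≤ ((n - 1 - S.card : ℕ) : ℤ) := hnot.1
        have h3 : ((n - 1 - S.card : ℕ) : ℤ) = n - 1 - S.card := by omega
        rw [h3] at h2
        have h4 : ((⌈(n : ℚ) / 2⌉ : ℤ) : ℚ) ≤ n - S.card := by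
          exact_mod_cast (by linarith : ⌈(n : ℚ) / 2⌉ ≤ (n : ℤ) - S.card)
        have h5 : (2 * S.card : ℚ) ≤ n := by linarith
        exact_mod_cast h5
      have hle := laplacianEigenvalue_le_of_isComplStar G hn hn3 hcS hS2
      rw [hsum] at hd
      have h2SR : (2 * S.card : ℝ) ≤ n := by exact_mod_cast h2S
      have hd1 : d ≤ 1 := by nlinarith
      refine ⟨by linarith, fun heq => ?_⟩
      have hd1' : d = 1 := by linarith
      rw [hd1', mul_one] at hd
      have hn2 : n = 2 * S.card := by exact_mod_cast hd
      have he : Even n := ⟨S.card, by omega⟩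
      exact Or.inr (Or.inr ⟨he, (hSt he).2 ⟨c, S, hcS, by omega⟩⟩)
  refine ⟨key.1, key.2, ?_⟩
  rintro (h | ⟨he, h⟩ | ⟨he, h⟩)
  · have h1 := le_laplacianEigenvalue_top G hn hn3 (hK.1 h)
    have hd0 : 0 ≤ d := nonneg_of_mul_nonneg_right
      (hd ▸ Finset.sum_nonneg fun v _ => Nat.cast_nonneg _ : 0 ≤ n * d) hn0
    exact le_antisymm key.1 (by linarith)
  · obtain ⟨A, hA, hadj⟩ := (h2K he).1 h
    have hnm : n = 2 * (n / 2) := by obtain ⟨m, rfl⟩ := he; omega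
    obtain ⟨h1, h2⟩ := le_laplacianEigenvalue_two_clique G hn hn3 hA hnm hadj
    have hnmR : (n : ℝ) = 2 * (n / 2 : ℕ) := by exact_mod_cast hnm
    have hdm : d = (n / 2 : ℕ) := by
      have h3 : n * d = n * (n / 2 : ℕ) := by rw [hd]; simp [h2, hn]
      exact mul_left_cancel₀ hn0.ne' h3
    exact le_antisymm key.1 (by linarith)
  · obtain ⟨c, S, hcS, hS⟩ := (hSt he).1 h
    have hnm : n = 2 * (n / 2) := by obtain ⟨m, rfl⟩ := he; omega
    have h1 := le_laplacianEigenvalue_complStar G hn hn3 hcS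
    have hdm : d = 1 := by
      have h3 : n * d = n * 1 := by
        rw [hd, sum_compl_degree_of_isComplStar G hcS, hS, mul_one]
        exact_mod_cast hnm.symm
      exact mul_left_cancel₀ hn0.ne' h3
    exact le_antisymm key.1 (by linarith)
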